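/- **Definitions.** Let $z_1,\dots,z_k$ ($k\ge 1$) be complex indeterminates. A $[p,n,k]$ *complex orthogonal design* (COD) is a $p\times n$ matrix $G$ whose entries lie in $\{0,\pm z_i,\pm z_i^*: 1\le i\le k\}$ and which satisfies $G^HG=(|z_1|^2+\dots+|z_k|^2)I_n$ identically. The *equivalence operations* on a $[p,n,k]$ COD are: permuting rows, negating a row, permuting columns, negating a column, permuting the names of the indeterminates, negating all instances of one indeterminate, and conjugating all instances of one indeterminate. Two CODs are *equivalent* if one can be changed into the other by a finite sequence of equivalence operations. A $[p,2m,k]$ COD $G$ is a *balanced complex orthogonal design* (BCOD) if (i) every row has exactly $m$ zero and $m$ nonzero entries; (ii) the nonzero entries of each row are either all conjugated or all non-conjugated; (iii) for every $j\in\{1,\dots,k\}$, $G$ can be transformed, by equivalence operations other than column negations and renamings of indeterminates, into a matrix having $2m$ rows of the form $$\begin{pmatrix} z_jI_m & M_j\\ -M_j^H & z_j^*I_m\end{pmatrix}\quad\text{with } M_j^T=-M_j .$$ A COD is *decomposable* if, up to the order of its rows, it is the vertical concatenation $\binom{G_1}{G_2}$ of two CODs (each with at least one indeterminate) on disjoint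 sets of indeterminates whose union is $\{z_1,\dots,z_k\}$; otherwise it is *indecomposable*. **Theorem.** Let $m\ge1$. Any two $[2^m,2m,2^{m-1}]$ BCODs are equivalent; moreover, one can be transformed into the other by equivalence operations without column negations. Consequently there is a unique indecomposable BCOD with $2m$ columns up to equivalence: there is an indecomposable $[2^m,2m,2^{m-1}]$ BCOD $G_0$, and every indecomposable $[p,2m,k]$ BCOD has $p=2^m$, $k=2^{m-1}$ and can be transformed into $G_0$ by equivalence operations, even without column negations. -/

import Mathlib

namespace COD

/-- A formal entry of a design in the complex indeterminates `z_i`, `i : Fin k`: either `0`, or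
`s * z_i` (`conj = false`), or `s * z_i^*` (`conj = true`), where `s = ±1`. -/
inductive Entry (k : ℕ) where
  | zero : Entry k
  | var (s : ℤˣ) (conj : Bool) (i : Fin k) : Entry k
  deriving DecidableEq

namespace Entry

variable {k l : ℕ}

instance : Zero (Entry k) := ⟨Entry.zero⟩

/-- The entry `z_i`. -/
def z (i : Fin k) : Entry k := Entry.var 1 false i

instance : Neg (Entry k) where
  neg
    | .zero => .zero
    | .var s b i => .var (-s) b i

/-- Complex conjugation of an entry. -/
instance : Star (Entry k) where
  star
    | .zero => .zero
    | .var s b i => .var s (!b) i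

/-- Rename the indeterminates. -/
def rename (f : Fin k → Fin l) : Entry k → Entry l
  | .zero => .zero
  | .var s b i => .var s b (f i)

/-- Negate the entry if its indeterminate is `z_i`. -/
def negVar (i : Fin k) : Entry k → Entry k
  | .zero => .zero
  | .var s b j => if j = i then .var (-s) b j else .var s b j

/-- Conjugate the entry if its indeterminate is `z_i`. -/
def conjVar (i : Fin k) : Entry k → Entry k
  | .zero => .zero
  | .var s b j => if j = i then .var s (!b) j else .var s b j

/-- The complex number obtained from an entry by giving values to the indeterminates. -/
noncomputable def eval (v : Fin k → ℂ) : Entry k → ℂ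
  | .zero => 0
  | .var s b i => ((s : ℤ) : ℂ) * (if b then star (v i) else v i)

end Entry

/-- `p × n` matrices whose entries are `0`, `± z_i` or `± z_i^*` with `i : Fin k`. -/
abbrev Design (p n k : ℕ) : Type := Matrix (Fin p) (Fin n) (Entry k)

/-- `G` is a `[p, n, k]` complex orthogonal design: there is at least one indeterminate, and
`Gᴴ G = (|z_1|² + ⋯ + |z_k|²) I_n` holds identically in the complex indeterminates. -/
def IsCOD {p n k : ℕ} (G : Design p n k) : Prop :=
  0 < k ∧ ∀ v : Fin k → ℂ,
    (G.map (Entry.eval v)).conjTranspose * G.map (Entry.eval v) =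
      ((∑ i, ‖v i‖ ^ 2 : ℝ) : ℂ) • (1 : Matrix (Fin n) (Fin n) ℂ)

/-- The elementary equivalence operations. -/
inductive Op (p n k : ℕ) where
  | rowPerm (σ : Equiv.Perm (Fin p)) : Op p n k
  | rowNeg (r : Fin p) : Op p n k
  | colPerm (σ : Equiv.Perm (Fin n)) : Op p n k
  | colNeg (c : Fin n) : Op p n k
  | instRename (τ : Equiv.Perm (Fin k)) : Op p n k
  | instNeg (i : Fin k) : Op p n k
  | instConj (i : Fin k) : Op p n k

namespace Op

variable {p n k : ℕ}

/-- The effect of an equivalence operation on a design. -/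
def apply : Op p n k → Design p n k → Design p n k
  | .rowPerm σ, G => G.submatrix σ id
  | .rowNeg r, G => Matrix.of fun r' c => if r' = r then -G r' c else G r' c
  | .colPerm σ, G => G.submatrix id σ
  | .colNeg c, G => Matrix.of fun r c' => if c' = c then -G r c' else G r c'
  | .instRename τ, G => G.map (Entry.rename τ)
  | .instNeg i, G => G.map (Entry.negVar i)
  | .instConj i, G => G.map (Entry.conjVar i)

/-- The operation is not a column negation. -/
def NotColNeg (o : Op p n k) : Prop := ∀ c, o ≠ .colNeg c

/-- The operation is not an instance renaming. -/
def NotRename (o : Op p n k) : Prop := ∀ τ, o ≠ .instRename τ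

end Op

/-- `H` is obtained from `G` by a finite sequence of operations, all satisfying `allowed`. -/
def TransformsTo {p n k : ℕ} (allowed : Op p n k → Prop) (G H : Design p n k) : Prop :=
  Relation.ReflTransGen (fun A B => ∃ o, allowed o ∧ B = o.apply A) G H

/-- Equivalence of designs: all operations are allowed. -/
def Equivalent {p n k : ℕ} (G H : Design p n k) : Prop :=
  TransformsTo (fun _ => True) G H

/-- Equivalence of designs without using column negations. -/
def EquivalentWithoutColNeg {p n k : ℕ} (G H : Design p n k) : Prop :=
  TransformsTo Op.NotColNeg G H

/-- The `2m` columns as a left half and a right half: `inl i` is column `i`, `inr i` is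
column `m + i`. -/
def halves (m : ℕ) : Fin m ⊕ Fin m ≃ Fin (2 * m) :=
  finSumFinEquiv.trans (finCongr (two_mul m).symm)

/-- `2m` rows of `G` (indexed by `f`) form the matrix
`[ z_j I_m , M ; -Mᴴ , z_j^* I_m ]` with `M` skew-symmetric. -/
def ContainsSkewB {p m k : ℕ} (j : Fin k) (G : Design p (2 * m) k) : Prop :=
  ∃ (f : Fin m ⊕ Fin m ↪ Fin p) (M : Matrix (Fin m) (Fin m) (Entry k)),
    M.transpose = -M ∧
    G.submatrix f (halves m) =
      Matrix.fromBlocks (Matrix.diagonal fun _ => Entry.z j) M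
        (-M.conjTranspose) (Matrix.diagonal fun _ => star (Entry.z j))

/-- All nonzero entries of a row are conjugated, or all are non-conjugated. -/
def ConjugationSeparated {p n k : ℕ} (G : Design p n k) : Prop :=
  ∀ r, ∃ b : Bool, ∀ c s b' i, G r c = Entry.var s b' i → b' = b

/-- Balanced complex orthogonal designs with `2m` columns. In the last condition, `G` is brought
into `B_j` form keeping the names of the indeterminates and without negating columns
(skew-symmetry of `M_j` is not invariant under column negation). -/
structure IsBCOD {p m k : ℕ} (G : Design p (2 * m) k) : Prop where
  isCOD : IsCOD G
  card_zero : ∀ r, (Finset.univ.filter fun c => G r c = 0).card = m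
  card_nonzero : ∀ r, (Finset.univ.filter fun c => G r c ≠ 0).card = m
  conjSep : ConjugationSeparated G
  skew : ∀ j : Fin k, ∃ G' : Design p (2 * m) k,
    TransformsTo (fun o => o.NotColNeg ∧ o.NotRename) G G' ∧ ContainsSkewB j G'

/-- The direct sum (vertical concatenation) of two designs on disjoint sets of indeterminates. -/
def directSum {p₁ p₂ n k₁ k₂ : ℕ} (G₁ : Design p₁ n k₁) (G₂ : Design p₂ n k₂) :
    Design (p₁ + p₂) n (k₁ + k₂) :=
  Matrix.of (Fin.append (fun r c => (G₁ r c).rename (Fin.castAdd k₂))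
    (fun r c => (G₂ r c).rename (Fin.natAdd k₁)))

/-- `G` is, up to the order of its rows and the numbering of its indeterminates, the direct sum
of two CODs. -/
def Decomposable {p n k : ℕ} (G : Design p n k) : Prop :=
  ∃ (p₁ p₂ k₁ k₂ : ℕ) (G₁ : Design p₁ n k₁) (G₂ : Design p₂ n k₂)
    (e : Fin p ≃ Fin (p₁ + p₂)) (t : Fin (k₁ + k₂) ≃ Fin k),
    IsCOD G₁ ∧ IsCOD G₂ ∧ G = ((directSum G₁ G₂).submatrix e id).map (Entry.rename t)

/-- `G` is not a direct sum of two CODs. -/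
def Indecomposable {p n k : ℕ} (G : Design p n k) : Prop := ¬ Decomposable G

/-- Transport a design along equalities of parameters. -/
def Design.cast {p p' n k k' : ℕ} (hp : p = p') (hk : k = k') (G : Design p n k) :
    Design p' n k' :=
  (G.submatrix (Fin.cast hp.symm) id).map (Entry.rename (Fin.cast hk))

end COD

/-! A connected BCOD is a signed cube. For each `z_j`, condition (iii) pairs the 2m columns by an
involution and splits them into two sides according to whether `z_j` is conjugated there. Since a
row has only m zeros, its support is forced (`LocalForm.ne_zero_iff`). If `z_l` shares a row with
`z_j`, describing that row and its skew mirror from both points of view shows that the two pairings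
agree (`LocalSystem.pair_eq`) and that the sides change on exactly two pairs.

So a connected design has one pairing into m pairs, and the sides of `z_j` on the pairs are the
coordinates of a vertex of the m-cube. Indeterminates sit at even vertices and unconjugated rows at
odd ones; row x holds, in direction i, the indeterminate at the neighbour `flip x i`. To see that
each vertex is used once, note that passing in direction i between an indeterminate and its row is
an involution, and these involutions commute; they give an equivariant map from the cube
(`exists_cube_map`), which is onto by connectedness. Conjugated rows mirror the unconjugated ones.

What remains is a sign on each edge. Skew-symmetry makes its product around every square -1, as for
`cubeSign`, so the ratio of the two is a coboundary (`exists_vertex_sign`). The vertex signs are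
absorbed by negating rows (odd vertices) and indeterminates (even vertices); columns are never
negated. Hence every connected BCOD is `Modelled`, and two modelled designs of the same size are
equivalent.

Connectedness has two sources: in an indecomposable COD no proper nonempty set of indeterminates is
closed under sharing rows, and in a BCOD such a set already has at least 2^(m-1) elements. Existence
comes from the standard signed cube. -/

namespace COD

/-! ### Combinatorics of the cube: flips, parity and edge signs. -/

section Cube

variable {m : ℕ}

/-- Flip one coordinate of a vertex of the cube. -/
def flip (x : Fin m → Bool) (i : Fin m) : Fin m → Bool := Function.update x i (!x i)

@[simp] theorem flip_same (x : Fin m → Bool) (i : Fin m) : flip x i i = !x i := by simp [flip]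

theorem flip_of_ne (x : Fin m → Bool) {i s : Fin m} (h : s ≠ i) : flip x i s = x s := by
  simp [flip, h]

@[simp] theorem flip_flip (x : Fin m → Bool) (i : Fin m) : flip (flip x i) i = x := by
  simp [flip]

theorem flip_comm (x : Fin m → Bool) (i s : Fin m) : flip (flip x i) s = flip (flip x s) i := by
  by_cases h : i = s
  · rw [h]
  · simp only [flip]
    rw [Function.update_comm h]
    simp [Function.update_of_ne h, Function.update_of_ne (Ne.symm h)]

/-- A property that is invariant under flips and holds at one vertex holds everywhere. -/
theorem flip_induction (P : (Fin m → Bool) → Prop) {x₀ : Fin m → Bool} (h₀ : P x₀)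
    (hs : ∀ x i, P x → P (flip x i)) (y : Fin m → Bool) : P y := by
  have key : ∀ F : Finset (Fin m), P (fun i => if i ∈ F then y i else x₀ i) := by
    intro F
    induction F using Finset.induction_on with
    | empty => simpa using h₀
    | insert a F ha ih =>
      by_cases hy : y a = x₀ a
      · convert ih using 2 with i
        by_cases hi : i = a
        · subst hi; simp [ha, hy]
        · simp [hi]
      · convert hs _ a ih using 1
        funext i
        by_cases hi : i = a
        · subst hi
          simp only [Finset.mem_insert_self, if_true, flip_same, ha, if_false]
          cases hh : y i <;> cases hx : x₀ i <;> simp_all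
        · rw [flip_of_ne _ hi]; simp [hi]
  simpa using key Finset.univ

/-- The parity of the number of `true` coordinates. -/
def parity (x : Fin m → Bool) : ZMod 2 := ∑ i, if x i then 1 else 0

@[simp] theorem parity_flip (x : Fin m → Bool) (i : Fin m) :
    parity (flip x i) = parity x + 1 := by
  simp only [parity]
  rw [← Finset.add_sum_erase _ _ (Finset.mem_univ i),
    ← Finset.add_sum_erase _ (fun t => if x t then (1 : ZMod 2) else 0) (Finset.mem_univ i)]
  have : ∑ t ∈ Finset.univ.erase i, (if flip x i t then (1 : ZMod 2) else 0) =
      ∑ t ∈ Finset.univ.erase i, (if x t then (1 : ZMod 2) else 0) :=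
    Finset.sum_congr rfl fun t ht => by rw [flip_of_ne _ (Finset.ne_of_mem_erase ht)]
  rw [this, flip_same]
  generalize ∑ t ∈ Finset.univ.erase i, (if x t then (1 : ZMod 2) else 0) = a
  generalize x i = b
  revert a b
  decide

theorem parity_cases (x : Fin m → Bool) : parity x = 0 ∨ parity x = 1 := by
  generalize parity x = a
  revert a; decide

/-- The even vertices of the cube. -/
abbrev EvenVertex (m : ℕ) := {x : Fin m → Bool // parity x = 0}

/-- The odd vertices of the cube. -/
abbrev OddVertex (m : ℕ) := {x : Fin m → Bool // parity x = 1}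

/-- The even neighbour of an odd vertex in a given direction. -/
def OddVertex.flip (x : OddVertex m) (i : Fin m) : EvenVertex m :=
  ⟨COD.flip x.1 i, by rw [parity_flip, x.2]; rfl⟩

/-- The odd neighbour of an even vertex in a given direction. -/
def EvenVertex.flip (x : EvenVertex m) (i : Fin m) : OddVertex m :=
  ⟨COD.flip x.1 i, by rw [parity_flip, x.2]; rfl⟩

@[simp] theorem OddVertex.flip_flip (x : OddVertex m) (i : Fin m) : (x.flip i).flip i = x :=
  Subtype.ext (COD.flip_flip _ _)

@[simp] theorem EvenVertex.flip_flip (x : EvenVertex m) (i : Fin m) : (x.flip i).flip i = x :=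
  Subtype.ext (COD.flip_flip _ _)

/-- Flipping a coordinate matches odd and even vertices. -/
def flipEquiv (i : Fin m) : OddVertex m ≃ EvenVertex m where
  toFun x := x.flip i
  invFun x := x.flip i
  left_inv x := x.flip_flip i
  right_inv x := x.flip_flip i

theorem card_even_add_card_odd : Fintype.card (EvenVertex m) + Fintype.card (OddVertex m) =
    2 ^ m := by
  have h : _ = _ - Fintype.card (EvenVertex m) :=
    Fintype.card_subtype_compl (fun x : Fin m → Bool => parity x = 0)
  have h2 : Fintype.card {x : Fin m → Bool // ¬ parity x = 0} = Fintype.card (OddVertex m) := by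
    refine Fintype.card_congr (Equiv.subtypeEquivRight fun x => ?_)
    generalize parity x = a
    revert a; decide
  have h3 : Fintype.card (EvenVertex m) ≤ _ :=
    Fintype.card_subtype_le (fun x : Fin m → Bool => parity x = 0)
  have h4 : Fintype.card (Fin m → Bool) = 2 ^ m := by simp
  omega

theorem card_even (hm : 1 ≤ m) : Fintype.card (EvenVertex m) = 2 ^ (m - 1) := by
  have h := card_even_add_card_odd (m := m)
  have h2 := Fintype.card_congr (flipEquiv (⟨0, hm⟩ : Fin m))
  obtain ⟨l, rfl⟩ : ∃ l, m = l + 1 := ⟨m - 1, by omega⟩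
  rw [pow_succ] at h
  simp only [Nat.add_sub_cancel]
  omega

theorem card_odd (hm : 1 ≤ m) : Fintype.card (OddVertex m) = 2 ^ (m - 1) := by
  rw [Fintype.card_congr (flipEquiv (⟨0, hm⟩ : Fin m)), card_even hm]

theorem card_odd_prod_bool (hm : 1 ≤ m) : Fintype.card (OddVertex m × Bool) = 2 ^ m := by
  rw [Fintype.card_prod, card_odd hm, Fintype.card_bool, ← pow_succ, Nat.sub_add_cancel hm]

/-- A set of vertices of constant parity that is closed under double flips contains all
vertices of that parity. -/
theorem mem_of_double_flip_closed (S : Set (Fin m → Bool)) {x₀ : Fin m → Bool} (h₀ : x₀ ∈ S)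
    (hs : ∀ x i s, i ≠ s → x ∈ S → flip (flip x i) s ∈ S) {y : Fin m → Bool}
    (hy : parity y = parity x₀) : y ∈ S := by
  -- Single flips change the parity, so the invariant also admits vertices one flip away from `S`.
  have key := flip_induction
    (fun y => (y ∈ S ∧ parity y = parity x₀) ∨
      ∃ z i, z ∈ S ∧ parity z = parity x₀ ∧ y = flip z i)
    (Or.inl ⟨h₀, rfl⟩) (by
      rintro x i (⟨hx, hp⟩ | ⟨z, s, hz, hp, rfl⟩)
      · exact Or.inr ⟨x, i, hx, hp, rfl⟩
      · left
        by_cases h : s = i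
        · subst h; simpa using ⟨hz, hp⟩
        · refine ⟨hs z s i h hz, ?_⟩
          rw [parity_flip, parity_flip, add_assoc, hp]
          exact add_zero _) y
  rcases key with ⟨h, -⟩ | ⟨z, i, -, hp, rfl⟩
  · exact h
  · rw [parity_flip, hp] at hy
    exact absurd hy (by generalize parity x₀ = a; revert a; decide)

/-- Commuting involutions define an equivariant map from the cube. -/
theorem exists_cube_map {X : Type*} : ∀ {m : ℕ} (P : X → Prop) (e : Fin m → X → X)
    (_ : ∀ i x, P x → P (e i x)) (_ : ∀ i x, P x → e i (e i x) = x)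
    (_ : ∀ i s x, P x → e i (e s x) = e s (e i x)) (x₀ : X) (_ : P x₀),
    ∃ Ψ : (Fin m → Bool) → X, Ψ (fun _ => false) = x₀ ∧ (∀ x, P (Ψ x)) ∧
      ∀ x i, Ψ (flip x i) = e i (Ψ x)
  | 0, P, e, _, _, _, x₀, h₀ => ⟨fun _ => x₀, rfl, fun _ => h₀, fun _ i => i.elim0⟩
  | m + 1, P, e, hP, hinv, hcomm, x₀, h₀ => by
    obtain ⟨Ψ, h1, h2, h3⟩ := exists_cube_map P (fun i : Fin m => e i.succ) (fun i => hP i.succ)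
      (fun i => hinv i.succ) (fun i s => hcomm i.succ s.succ) x₀ h₀
    have htail0 : ∀ x : Fin (m + 1) → Bool, Fin.tail (flip x 0) = Fin.tail x := by
      intro x; funext t; simp [Fin.tail, flip]
    have htails : ∀ (x : Fin (m + 1) → Bool) (i : Fin m),
        Fin.tail (flip x i.succ) = flip (Fin.tail x) i := by
      intro x i; funext t
      by_cases h : t = i
      · subst h; simp [Fin.tail]
      · rw [flip_of_ne _ h]
        simp only [Fin.tail]
        rw [flip_of_ne]
        simpa using h
    -- Extend the map built on the last m directions by applying `e 0` when the new coordinate is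
    -- true; commutation keeps it equivariant in the old directions.
    refine ⟨fun x => if x 0 then e 0 (Ψ (Fin.tail x)) else Ψ (Fin.tail x), ?_, ?_, ?_⟩
    · simpa [Fin.tail_def] using h1
    · intro x
      dsimp only
      split_ifs
      · exact hP _ _ (h2 _)
      · exact h2 _
    · intro x i
      dsimp only
      refine Fin.cases ?_ (fun i => ?_) i
      · rw [htail0, flip_same]
        cases x 0
        · simp
        · simp [hinv _ _ (h2 _)]
      · rw [htails, flip_of_ne x (Fin.succ_ne_zero i).symm, h3]
        cases x 0
        · simp
        · simp [hcomm _ _ _ (h2 _)]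

/-- A sign on the edges of the cube whose product around every square is `1` is the coboundary
of a sign on the vertices. -/
theorem exists_vertex_sign (δ : (Fin m → Bool) → Fin m → ℤˣ)
    (hsymm : ∀ x i, δ (flip x i) i = δ x i)
    (hclosed : ∀ x i s, δ x i * δ (flip x i) s = δ x s * δ (flip x s) i) :
    ∃ θ : (Fin m → Bool) → ℤˣ, ∀ x i, δ x i = θ x * θ (flip x i) := by
  -- Lift the cube to its double cover: the hypotheses on `δ` say exactly that the lifted flips are
  -- commuting involutions. The sign component of the lift is `θ`.
  obtain ⟨Ψ, h0, -, h⟩ := exists_cube_map (X := (Fin m → Bool) × ℤˣ) (fun _ => True)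
    (fun i q => (flip q.1 i, q.2 * δ q.1 i)) (fun _ _ _ => trivial)
    (by
      rintro i ⟨x, s⟩ -
      simp [hsymm, mul_assoc, Int.units_mul_self])
    (by
      rintro i s ⟨x, t⟩ -
      simp only [Prod.mk.injEq]
      exact ⟨flip_comm _ _ _, by rw [mul_assoc, mul_assoc, hclosed]⟩)
    (fun _ => false, 1) trivial
  have hfst : ∀ x, (Ψ x).1 = x :=
    flip_induction _ (by rw [h0]) fun x i hx => by rw [h]; simp [hx]
  refine ⟨fun x => (Ψ x).2, fun x i => ?_⟩
  dsimp only
  rw [h, ← mul_assoc, Int.units_mul_self, one_mul, hfst]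

/-- The standard edge sign of the cube. -/
def cubeSign (x : Fin m → Bool) (i : Fin m) : ℤˣ :=
  ∏ t ∈ Finset.univ.filter (· < i), if x t then -1 else 1

theorem cubeSign_flip_of_le (x : Fin m → Bool) {i s : Fin m} (h : i ≤ s) :
    cubeSign (flip x s) i = cubeSign x i := by
  refine Finset.prod_congr rfl fun t ht => ?_
  rw [flip_of_ne]
  have := (Finset.mem_filter.1 ht).2
  exact (lt_of_lt_of_le this h).ne

theorem cubeSign_flip_of_lt (x : Fin m → Bool) {i s : Fin m} (h : s < i) :
    cubeSign (flip x s) i = - cubeSign x i := by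
  have hs : s ∈ Finset.univ.filter (· < i) := by simpa using h
  simp only [cubeSign]
  rw [← Finset.mul_prod_erase _ _ hs,
    ← Finset.mul_prod_erase _ (fun t => if x t then (-1 : ℤˣ) else 1) hs]
  have : ∏ t ∈ (Finset.univ.filter (· < i)).erase s, (if flip x s t then (-1 : ℤˣ) else 1) =
      ∏ t ∈ (Finset.univ.filter (· < i)).erase s, (if x t then (-1 : ℤˣ) else 1) :=
    Finset.prod_congr rfl fun t ht => by rw [flip_of_ne _ (Finset.ne_of_mem_erase ht)]
  rw [this, flip_same]
  cases hx : x s <;> simp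

/-- The product of the standard signs around every square is `-1`. -/
theorem cubeSign_square (x : Fin m → Bool) {i s : Fin m} (h : i ≠ s) :
    cubeSign x i * cubeSign x s =
      -(cubeSign (flip (flip x i) s) i * cubeSign (flip (flip x i) s) s) := by
  rcases lt_or_gt_of_ne h with h | h
  · rw [cubeSign_flip_of_le _ h.le, cubeSign_flip_of_le _ le_rfl, cubeSign_flip_of_le _ le_rfl,
      cubeSign_flip_of_lt _ h]
    simp
  · rw [cubeSign_flip_of_lt _ h, cubeSign_flip_of_le _ le_rfl, cubeSign_flip_of_le _ le_rfl,
      cubeSign_flip_of_le _ h.le]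
    simp

/-- An edge in direction i has the same sign at both ends, so the far edges of the square can be
read from the neighbours of `x`. -/
theorem cubeSign_square_edges (x : Fin m → Bool) {i s : Fin m} (h : i ≠ s) :
    cubeSign x i * cubeSign x s = -(cubeSign (flip x s) i * cubeSign (flip x i) s) := by
  rw [cubeSign_square x h, cubeSign_flip_of_le (flip x i) (le_refl s), flip_comm,
    cubeSign_flip_of_le (flip x s) (le_refl i)]

end Cube

/-! ### Signs, conjugation and twisting of entries. -/

namespace Entry

variable {k l : ℕ}

instance : MulAction ℤˣ (Entry k) where
  smul t
    | .zero => .zero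
    | .var s b i => .var (t * s) b i
  one_smul e := by
    cases e
    · rfl
    · change Entry.var (1 * _) _ _ = _
      rw [one_mul]
  mul_smul t u e := by
    cases e
    · rfl
    · change Entry.var (t * u * _) _ _ = Entry.var (t * (u * _)) _ _
      rw [mul_assoc]

@[simp] theorem smul_zero_entry (t : ℤˣ) : t • (0 : Entry k) = 0 := rfl
@[simp] theorem smul_var (t s : ℤˣ) (b : Bool) (i : Fin k) :
    t • Entry.var s b i = Entry.var (t * s) b i := rfl
@[simp] theorem neg_zero_entry : -(0 : Entry k) = 0 := rfl
@[simp] theorem neg_var (s : ℤˣ) (b : Bool) (i : Fin k) :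
    -Entry.var s b i = Entry.var (-s) b i := rfl
@[simp] theorem star_zero_entry : star (0 : Entry k) = 0 := rfl
@[simp] theorem star_var (s : ℤˣ) (b : Bool) (i : Fin k) :
    star (Entry.var s b i) = Entry.var s (!b) i := rfl
@[simp] theorem rename_zero (f : Fin k → Fin l) : rename f 0 = 0 := rfl
@[simp] theorem rename_var (f : Fin k → Fin l) (s : ℤˣ) (b : Bool) (i : Fin k) :
    rename f (Entry.var s b i) = Entry.var s b (f i) := rfl
@[simp] theorem var_ne_zero (s : ℤˣ) (b : Bool) (i : Fin k) : Entry.var s b i ≠ 0 := nofun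
@[simp] theorem zero_ne_var (s : ℤˣ) (b : Bool) (i : Fin k) : 0 ≠ Entry.var s b i := nofun

@[elab_as_elim, induction_eliminator]
theorem ind {P : Entry k → Prop} (zero : P 0) (var : ∀ s b i, P (.var s b i)) (e : Entry k) :
    P e := by
  cases e
  · exact zero
  · exact var _ _ _

theorem exists_var_of_ne_zero {e : Entry k} (h : e ≠ 0) : ∃ s b i, e = .var s b i := by
  induction e with
  | zero => exact absurd rfl h
  | var s b i => exact ⟨s, b, i, rfl⟩

theorem neg_neg_entry (e : Entry k) : -(-e) = e := by
  induction e <;> simp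

theorem eq_zero_of_eq_neg {e : Entry k} (h : e = -e) : e = 0 := by
  induction e with
  | zero => rfl
  | var s b i =>
    simp only [neg_var, var.injEq, and_true] at h
    exact absurd h (by rcases Int.units_eq_one_or s with rfl | rfl <;> decide)

theorem smul_neg_entry (t : ℤˣ) (e : Entry k) : t • (-e) = -(t • e) := by
  induction e <;> simp

theorem neg_one_smul_entry (e : Entry k) : (-1 : ℤˣ) • e = -e := by
  induction e <;> simp

theorem star_smul_entry (t : ℤˣ) (e : Entry k) : star (t • e) = t • star e := by
  induction e <;> simp

theorem star_neg_entry (e : Entry k) : star (-e) = -star e := by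
  induction e <;> simp

theorem star_star_entry (e : Entry k) : star (star e) = e := by
  induction e <;> simp

theorem smul_smul_self (t : ℤˣ) (e : Entry k) : t • t • e = e := by
  rw [smul_smul, Int.units_mul_self, one_smul]

/-- Change signs and conjugations of the indeterminates. -/
def twist (η : Fin k → ℤˣ) (β : Fin k → Bool) : Entry k → Entry k
  | .zero => .zero
  | .var s b i => .var (η i * s) (xor b (β i)) i

variable (η : Fin k → ℤˣ) (β : Fin k → Bool)

@[simp] theorem twist_zero : twist η β 0 = 0 := rfl
@[simp] theorem twist_var (s : ℤˣ) (b : Bool) (i : Fin k) :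
    twist η β (.var s b i) = .var (η i * s) (xor b (β i)) i := rfl

theorem twist_smul (t : ℤˣ) (e : Entry k) : twist η β (t • e) = t • twist η β e := by
  induction e <;> simp [mul_left_comm]

theorem twist_neg (e : Entry k) : twist η β (-e) = -twist η β e := by
  induction e <;> simp

theorem twist_star (e : Entry k) : twist η β (star e) = star (twist η β e) := by
  induction e <;> simp

theorem twist_injective : Function.Injective (twist η β) := by
  intro e f h
  induction e with
  | zero =>
    induction f with
    | zero => rfl
    | var s b i => simp at h
  | var s b i =>
    induction f with
    | zero => simp at h
    | var s' b' i' =>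
      simp only [twist_var, var.injEq] at h
      obtain ⟨h1, h2, rfl⟩ := h
      simp_all

theorem twist_eq_zero {e : Entry k} : twist η β e = 0 ↔ e = 0 := by
  induction e <;> simp

end Entry

/-! ### Normal form for sequences of the operations allowed in condition (iii). -/

section Similarity

variable {p n k : ℕ}

/-- The combined effect of row and column permutations, row negations and sign changes and
conjugations of indeterminates. -/
def Similar (G H : Design p n k) : Prop :=
  ∃ (σ : Equiv.Perm (Fin p)) (κ : Equiv.Perm (Fin n)) (ρ : Fin p → ℤˣ) (η : Fin k → ℤˣ)
    (β : Fin k → Bool), ∀ r c, H r c = ρ r • (G (σ r) (κ c)).twist η β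

theorem Similar.apply {G H : Design p n k} (h : Similar G H) {o : Op p n k}
    (ho : o.NotColNeg ∧ o.NotRename) : Similar G (o.apply H) := by
  obtain ⟨σ, κ, ρ, η, β, h⟩ := h
  cases o with
  | rowPerm τ =>
    refine ⟨τ.trans σ, κ, ρ ∘ τ, η, β, fun r c => ?_⟩
    simp [Op.apply, h]
  | rowNeg q =>
    refine ⟨σ, κ, fun r => if r = q then -ρ r else ρ r, η, β, fun r c => ?_⟩
    by_cases hr : r = q
    · simp only [Op.apply, Matrix.of_apply, h, hr, if_true]
      rw [← Entry.neg_one_smul_entry, smul_smul, neg_one_mul]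
    · simp [Op.apply, h, hr]
  | colPerm τ =>
    refine ⟨σ, τ.trans κ, ρ, η, β, fun r c => ?_⟩
    simp [Op.apply, h]
  | colNeg q => exact absurd rfl (ho.1 q)
  | instRename τ => exact absurd rfl (ho.2 τ)
  | instNeg j =>
    refine ⟨σ, κ, ρ, fun i => if i = j then -η i else η i, β, fun r c => ?_⟩
    simp only [Op.apply, Matrix.map_apply, h]
    induction G (σ r) (κ c) with
    | zero => rfl
    | var s b i =>
      by_cases hi : i = j <;> simp [Entry.negVar, hi]
  | instConj j =>
    refine ⟨σ, κ, ρ, η, fun i => if i = j then !β i else β i, fun r c => ?_⟩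
    simp only [Op.apply, Matrix.map_apply, h]
    induction G (σ r) (κ c) with
    | zero => rfl
    | var s b i =>
      by_cases hi : i = j <;> simp [Entry.conjVar, hi]

theorem TransformsTo.similar {G H : Design p n k}
    (h : TransformsTo (fun o => o.NotColNeg ∧ o.NotRename) G H) : Similar G H := by
  induction h with
  | refl =>
    refine ⟨1, 1, 1, 1, fun _ => false, fun r c => ?_⟩
    simp only [Equiv.Perm.one_apply, Pi.one_apply, one_smul]
    induction G r c <;> simp
  | tail _ h ih =>
    obtain ⟨o, ho, rfl⟩ := h
    exact ih.apply ho

end Similarity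

/-! ### The rows containing a fixed indeterminate. -/

section Local

variable {p n k : ℕ}

/-- The shape of the rows of `G` that contain the indeterminate `z_j`. The columns are paired by
the involution `π`; in column `c` the indeterminate `z_j` occurs in row `R c`, with sign `ρ c`,
and it is conjugated if and only if `T c`. -/
structure LocalForm (G : Design p n k) (j : Fin k) (π : Fin n → Fin n) (T : Fin n → Bool)
    (R : Fin n → Fin p) (ρ : Fin n → ℤˣ) : Prop where
  invol : ∀ c, π (π c) = c
  side : ∀ c, T (π c) = !T c
  diag : ∀ c, G (R c) c = .var (ρ c) (T c) j
  zero_side : ∀ c d, T d = T c → d ≠ c → G (R c) d = 0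
  zero_pair : ∀ c, G (R c) (π c) = 0
  ne_zero : ∀ c d, T d = T c → d ≠ c → G (R c) (π d) ≠ 0
  skew : ∀ c d, T d = T c → d ≠ c → ρ c • G (R c) (π d) = -(ρ d • G (R d) (π c))
  star : ∀ c d, ρ (π c) • G (R (π c)) (π d) = star (ρ c • G (R c) d)

/-- In every column every indeterminate occurs in exactly one row. -/
theorem IsCOD.existsUnique_row {G : Design p n k} (hG : IsCOD G) (j : Fin k) (c : Fin n) :
    ∃! r, ∃ s b, G r c = .var s b j := by
  classical
  -- At the indicator of `j`, the diagonal entry of `Gᴴ G` at `c` counts the rows with `z_j` in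
  -- column `c`, and it equals 1.
  have h := congrFun (congrFun (hG.2 (Pi.single j 1)) c) c
  have hval : ∀ r, star ((G r c).eval (Pi.single j 1)) * (G r c).eval (Pi.single j 1) =
      if ∃ s b, G r c = .var s b j then (1 : ℂ) else 0 := by
    intro r
    induction hx : G r c with
    | zero => simp [show (0 : Entry k) = Entry.zero from rfl, Entry.eval]
    | var s b i =>
      by_cases hi : i = j
      · subst hi
        rcases Int.units_eq_one_or s with rfl | rfl <;> cases b <;> simp [Entry.eval]
      · have : ¬ ∃ s' b', Entry.var s b i = .var s' b' j := by
          rintro ⟨s', b', h'⟩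
          simp only [Entry.var.injEq] at h'
          exact hi h'.2.2
        rw [if_neg this]
        cases b <;> simp [Entry.eval, hi]
  have hsum : ((∑ i, ‖(Pi.single j 1 : Fin k → ℂ) i‖ ^ 2 : ℝ) : ℂ) = 1 := by
    have : ∀ i, ‖(Pi.single j 1 : Fin k → ℂ) i‖ ^ 2 = if i = j then (1 : ℝ) else 0 := by
      intro i
      by_cases hi : i = j
      · subst hi; simp
      · simp [hi]
    simp [this]
  rw [hsum] at h
  simp only [Matrix.mul_apply, Matrix.conjTranspose_apply, Matrix.map_apply, hval, one_smul,
    Matrix.one_apply_eq] at h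
  rw [Finset.sum_boole] at h
  have hcard : (Finset.univ.filter fun r => ∃ s b, G r c = .var s b j).card = 1 := by
    exact_mod_cast h
  obtain ⟨r, hr⟩ := Finset.card_eq_one.1 hcard
  have hmem : ∀ q, (∃ s b, G q c = .var s b j) ↔ q = r := fun q => by
    have := Finset.ext_iff.1 hr q
    simpa using this
  exact ⟨r, (hmem r).2 rfl, fun q hq => (hmem q).1 hq⟩

/-- The block relations pull back to `G` itself because `twist` is injective and commutes with
signs, negation and `star`. -/
theorem IsBCOD.exists_localForm {m : ℕ} {G : Design p (2 * m) k} (hG : IsBCOD G) (j : Fin k) :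
    ∃ π T R ρ, LocalForm G j π T R ρ := by
  obtain ⟨G', hT, f, M, hM, hB⟩ := hG.skew j
  obtain ⟨σ, κ, ρ₀, η, β, hs⟩ := hT.similar
  have hMij : ∀ i l, M l i = -M i l := fun i l => by
    have := congrFun (congrFun hM i) l
    simpa using this
  have hM0 : ∀ i, M i i = 0 := fun i => Entry.eq_zero_of_eq_neg (hMij i i)
  set h : Fin m ⊕ Fin m ≃ Fin (2 * m) := (halves m).trans κ with hh
  set F : Fin m ⊕ Fin m → Fin p := fun a => σ (f a) with hF
  set s : Fin m ⊕ Fin m → ℤˣ := fun a => ρ₀ (f a) with hsdef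
  have hE : ∀ a c, s a • (G (F a) (h c)).twist η β =
      Matrix.fromBlocks (Matrix.diagonal fun _ => Entry.z j) M
        (-M.conjTranspose) (Matrix.diagonal fun _ => star (Entry.z j)) a c := by
    intro a c
    rw [← hB, Matrix.submatrix_apply, hs]
    rfl
  have hdiag : ∀ a, G (F a) (h a) = .var (η j * s a) (xor (β j) a.isRight) j := by
    intro a
    apply Entry.twist_injective η β
    have h1 : s a • (G (F a) (h a)).twist η β = .var 1 a.isRight j := by
      rw [hE]
      cases a <;> simp [Entry.z]
    rw [← Entry.smul_smul_self (s a) (Entry.twist _ _ _), h1]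
    simp only [Entry.smul_var, mul_one, Entry.twist_var, ← mul_assoc, Int.units_mul_self, one_mul]
    cases β j <;> cases a.isRight <;> rfl
  have hzs : ∀ a c, c.isRight = a.isRight → c ≠ a → G (F a) (h c) = 0 := by
    intro a c hac hne
    rw [← Entry.twist_eq_zero η β, ← Entry.smul_smul_self (s a) (Entry.twist _ _ _), hE]
    rcases a with a | a <;> rcases c with c | c <;> simp at hac hne ⊢
    · rw [Matrix.diagonal_apply_ne _ (Ne.symm hne)]; rfl
    · rw [Matrix.diagonal_apply_ne _ (Ne.symm hne)]; rfl
  have hzp : ∀ a, G (F a) (h a.swap) = 0 := by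
    intro a
    rw [← Entry.twist_eq_zero η β, ← Entry.smul_smul_self (s a) (Entry.twist _ _ _), hE]
    rcases a with a | a <;> simp [hM0]
  -- The m - 1 other columns on the side of `a` and the partner of `a` already exhaust the m zeros
  -- of the row.
  have hcard : ∀ a c, c.isRight = a.isRight → c ≠ a → G (F a) (h c.swap) ≠ 0 := by
    intro a c hac hne h0
    have hsub : (insert (h c.swap) (insert (h a.swap)
        (((Finset.univ.filter fun d : Fin m ⊕ Fin m => d.isRight = a.isRight).erase a).map
          h.toEmbedding))) ⊆ Finset.univ.filter fun d => G (F a) d = 0 := by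
      intro d hd
      simp only [Finset.mem_insert, Finset.mem_map, Finset.mem_erase, Finset.mem_filter,
        Finset.mem_univ, true_and] at hd ⊢
      rcases hd with rfl | rfl | ⟨d, ⟨hda, hdr⟩, rfl⟩
      · exact h0
      · exact hzp a
      · exact hzs a d hdr hda
    have hout : ∀ c : Fin m ⊕ Fin m, c.isRight = a.isRight → h c.swap ∉
        ((Finset.univ.filter fun d : Fin m ⊕ Fin m => d.isRight = a.isRight).erase a).map
          h.toEmbedding := by
      intro c hc hmem
      obtain ⟨d, hd, he⟩ := Finset.mem_map.1 hmem
      have hd := (Finset.mem_filter.1 (Finset.mem_of_mem_erase hd)).2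
      rw [h.injective he, ← hc] at hd
      cases c <;> simp at hd
    have hle := Finset.card_le_card hsub
    rw [hG.card_zero, Finset.card_insert_of_notMem, Finset.card_insert_of_notMem,
      Finset.card_map, Finset.card_erase_of_mem (by simp)] at hle
    · have hc : (Finset.univ.filter fun d : Fin m ⊕ Fin m => d.isRight = a.isRight).card = m := by
        rw [Finset.card_filter, Fintype.sum_sum_type]
        cases a <;> simp
      rw [hc] at hle
      omega
    · exact hout a rfl
    · rw [Finset.mem_insert, not_or]
      refine ⟨fun he => hne ?_, hout c hac⟩
      simpa using congrArg Sum.swap (h.injective he)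
  have key : ∀ a b c d, s a • (G (F a) (h b)).twist η β = -(s c • (G (F c) (h d)).twist η β) →
      (η j * s a) • G (F a) (h b) = -((η j * s c) • G (F c) (h d)) := by
    intro a b c d he
    rw [← Entry.twist_smul, ← Entry.twist_smul, ← Entry.twist_neg] at he
    rw [mul_smul, Entry.twist_injective η β he, Entry.smul_neg_entry, ← mul_smul]
  have key2 : ∀ a b c d, s a • (G (F a) (h b)).twist η β =
        Star.star (s c • (G (F c) (h d)).twist η β) →
      (η j * s a) • G (F a) (h b) = Star.star ((η j * s c) • G (F c) (h d)) := by
    intro a b c d he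
    rw [← Entry.twist_smul, ← Entry.twist_smul, ← Entry.twist_star] at he
    rw [mul_smul, Entry.twist_injective η β he, ← Entry.star_smul_entry, ← mul_smul]
  refine ⟨fun c => h (h.symm c).swap, fun c => xor (β j) (h.symm c).isRight,
    fun c => F (h.symm c), fun c => η j * s (h.symm c), ?_, ?_, ?_, ?_, ?_, ?_, ?_, ?_⟩
  · intro c; simp
  · intro c
    obtain ⟨c, rfl⟩ := h.surjective c
    cases c <;> simp
  · intro c
    obtain ⟨c, rfl⟩ := h.surjective c
    simpa using hdiag c
  · intro c d
    obtain ⟨c, rfl⟩ := h.surjective c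
    obtain ⟨d, rfl⟩ := h.surjective d
    simpa using hzs c d
  · intro c
    obtain ⟨c, rfl⟩ := h.surjective c
    simpa using hzp c
  · intro c d
    obtain ⟨c, rfl⟩ := h.surjective c
    obtain ⟨d, rfl⟩ := h.surjective d
    simpa using hcard c d
  · intro c d
    obtain ⟨c, rfl⟩ := h.surjective c
    obtain ⟨d, rfl⟩ := h.surjective d
    simp only [Equiv.symm_apply_apply]
    intro hcd hne
    apply key
    rw [hE, hE]
    rcases c with c | c <;> rcases d with d | d <;> simp at hcd hne ⊢
    · rw [hMij]
    · rw [hMij c d, Entry.star_neg_entry]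
  · intro c d
    obtain ⟨c, rfl⟩ := h.surjective c
    obtain ⟨d, rfl⟩ := h.surjective d
    simp only [Equiv.symm_apply_apply]
    apply key2
    rw [hE, hE]
    rcases c with c | c <;> rcases d with d | d <;> simp
    · by_cases hcd : c = d
      · subst hcd; simp
      · simp only [Matrix.diagonal_apply_ne _ hcd]; rfl
    · rw [hMij c d, Entry.star_neg_entry, Entry.neg_neg_entry]
    · rw [hMij c d]
      iterate 3 rw [Entry.star_neg_entry]
      rw [Entry.neg_neg_entry, Entry.star_star_entry]
    · by_cases hcd : c = d
      · subst hcd; simp [Entry.star_star_entry]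
      · simp only [Matrix.diagonal_apply_ne _ hcd]; rfl

end Local

/-! ### Indeterminates sharing a row have the same column pairing. -/

section Pairing

variable {p n k : ℕ}

theorem LocalForm.ne_zero_iff {G : Design p n k} {j : Fin k} {π : Fin n → Fin n}
    {T : Fin n → Bool} {R : Fin n → Fin p} {ρ : Fin n → ℤˣ} (h : LocalForm G j π T R ρ)
    (c x : Fin n) : G (R c) x ≠ 0 ↔ x = c ∨ (T x ≠ T c ∧ x ≠ π c) := by
  by_cases hxc : x = c
  · subst hxc; simp [h.diag]
  by_cases hT : T x = T c
  · simp [hxc, hT, h.zero_side c x hT hxc]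
  by_cases hp : x = π c
  · subst hp; simp [h.zero_pair, hxc]
  · have hT' : T (π x) = T c := by
      rw [h.side]
      revert hT
      cases T x <;> cases T c <;> simp
    have hne : π x ≠ c := fun e => hp (by rw [← e, h.invol])
    have := h.ne_zero c (π x) hT' hne
    rw [h.invol] at this
    simp [hT, hp, this]

/-- Local forms at all indeterminates of a design. -/
structure LocalSystem (G : Design p n k) (π : Fin k → Fin n → Fin n) (T : Fin k → Fin n → Bool)
    (R : Fin k → Fin n → Fin p) (ρ : Fin k → Fin n → ℤˣ) : Prop where
  form : ∀ j, LocalForm G j (π j) (T j) (R j) (ρ j)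
  sep : ConjugationSeparated G
  unique : ∀ {j c r r' s s' b b'}, G r c = .var s b j → G r' c = .var s' b' j → r = r'

theorem IsBCOD.exists_localSystem {m : ℕ} {G : Design p (2 * m) k} (hG : IsBCOD G) :
    ∃ π T R ρ, LocalSystem G π T R ρ := by
  choose π T R ρ h using hG.exists_localForm
  refine ⟨π, T, R, ρ, h, hG.conjSep, ?_⟩
  intro j c r r' s s' b b' h1 h2
  exact (hG.isCOD.existsUnique_row j c).unique ⟨s, b, h1⟩ ⟨s', b', h2⟩

namespace LocalSystem

variable {G : Design p n k} {π : Fin k → Fin n → Fin n} {T : Fin k → Fin n → Bool}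
    {R : Fin k → Fin n → Fin p} {ρ : Fin k → Fin n → ℤˣ}

theorem eq_of_var (h : LocalSystem G π T R ρ)
    {j : Fin k} {c : Fin n} {r : Fin p} {s : ℤˣ} {b : Bool}
    (hr : G r c = .var s b j) : r = R j c ∧ s = ρ j c ∧ b = T j c := by
  have hd := (h.form j).diag c
  obtain rfl := h.unique hr hd
  rw [hd] at hr
  simp only [Entry.var.injEq, and_true] at hr
  exact ⟨rfl, hr.1.symm, hr.2.symm⟩

theorem conj_eq (h : LocalSystem G π T R ρ)
    {j l : Fin k} {c x : Fin n} {s : ℤˣ} {b : Bool}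
    (hx : G (R j c) x = .var s b l) : b = T j c := by
  obtain ⟨b₀, hb⟩ := h.sep (R j c)
  rw [hb _ _ _ _ hx, hb _ _ _ _ ((h.form j).diag c)]

/-- The indeterminate at the mirror position. -/
theorem mirror (h : LocalSystem G π T R ρ)
    {j l : Fin k} {c d : Fin n} (hT : T j d = T j c) (hne : d ≠ c) {s : ℤˣ} {b : Bool}
    (hl : G (R j c) (π j d) = .var s b l) : ∃ s', G (R j d) (π j c) = .var s' b l := by
  have hsk := (h.form j).skew c d hT hne
  rw [hl] at hsk
  obtain ⟨s', b', l', he⟩ := Entry.exists_var_of_ne_zero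
    ((h.form j).ne_zero d c hT.symm hne.symm)
  rw [he] at hsk ⊢
  simp only [Entry.smul_var, Entry.neg_var, Entry.var.injEq] at hsk
  obtain ⟨-, rfl, rfl⟩ := hsk
  exact ⟨s', rfl⟩

/-- Skew-symmetry puts `z_l` in both rows `R j c` and `R j d`, so these are also rows of `z_l`; as
conjugation is constant along a row, `z_l` is conjugated there exactly when `z_j` is. -/
theorem side_mirror (h : LocalSystem G π T R ρ)
    {j l : Fin k} {c d : Fin n} (hT : T j d = T j c) (hne : d ≠ c)
    {s : ℤˣ} {b : Bool} (hl : G (R j c) (π j d) = .var s b l) :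
    R l (π j d) = R j c ∧ R l (π j c) = R j d ∧ T l (π j d) = T j c ∧ T l (π j c) = T j c := by
  obtain ⟨s', hl'⟩ := h.mirror hT hne hl
  have hb := h.conj_eq hl
  obtain ⟨h1, -, h2⟩ := h.eq_of_var hl
  obtain ⟨h3, -, h4⟩ := h.eq_of_var hl'
  exact ⟨h1.symm, h3.symm, by rw [← h2, hb], by rw [← h4, hb]⟩

/-- Column `c` is in the support of the row. Seen from `z_l`, whose own column there is `π j d ≠ c`,
it must lie on the opposite side. -/
theorem side_step_left (h : LocalSystem G π T R ρ)
    {j l : Fin k} {c d : Fin n} (hT : T j d = T j c) (hne : d ≠ c)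
    {s : ℤˣ} {b : Bool} (hl : G (R j c) (π j d) = .var s b l) : T l c = !T j c := by
  obtain ⟨h1, -, h3, -⟩ := h.side_mirror hT hne hl
  have hc : G (R l (π j d)) c ≠ 0 := by rw [h1, (h.form j).diag]; simp
  rw [(h.form l).ne_zero_iff, h3] at hc
  rcases hc with hc | ⟨hc, -⟩
  · have := (h.form j).side d
    rw [← hc, hT] at this
    simp at this
  · revert hc; cases T l c <;> cases T j c <;> simp

theorem side_step_right (h : LocalSystem G π T R ρ)
    {j l : Fin k} {c d : Fin n} (hT : T j d = T j c) (hne : d ≠ c)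
    {s : ℤˣ} {b : Bool} (hl : G (R j c) (π j d) = .var s b l) : T l d = !T j d := by
  obtain ⟨s', hl'⟩ := h.mirror hT hne hl
  exact h.side_step_left hT.symm hne.symm hl'

/-- If `x` is opposite to `c` for `j`, the row is nonzero at `x`, so `x` is opposite to `π j d` for
`l`. If `x` is on the side of `c`, both rows vanish at `x`; changing side would make `x` the
`l`-partner of both `π j d` and `π j c`. -/
theorem side_step_other (h : LocalSystem G π T R ρ)
    {j l : Fin k} {c d : Fin n} (hT : T j d = T j c) (hne : d ≠ c)
    {s : ℤˣ} {b : Bool} (hl : G (R j c) (π j d) = .var s b l) {x : Fin n} (hxc : x ≠ c)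
    (hxd : x ≠ d) (hxc' : x ≠ π j c) (hxd' : x ≠ π j d) : T l x = T j x := by
  obtain ⟨h1, h2, h3, h4⟩ := h.side_mirror hT hne hl
  have e1 := (h.form l).ne_zero_iff (π j d) x
  rw [h1, (h.form j).ne_zero_iff, h3] at e1
  have e2 := (h.form l).ne_zero_iff (π j c) x
  rw [h2, (h.form j).ne_zero_iff, h4, hT] at e2
  have hπ : x = π l (π j d) → x ≠ π l (π j c) := by
    intro ha hb
    rw [ha] at hb
    have hb := congrArg (π l) hb
    rw [(h.form l).invol, (h.form l).invol] at hb
    have hb := congrArg (π j) hb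
    rw [(h.form j).invol, (h.form j).invol] at hb
    exact hne hb
  by_cases hTx : T j x = T j c
  · have hTl : T l x = T j c := by
      by_contra hcon
      simp only [hxc, hxd, hxc', hxd', hTx, ne_eq, not_true_eq_false, false_and, or_false,
        hcon, not_false_eq_true, true_and, false_or, false_iff, not_not] at e1 e2
      exact hπ e1 e2
    rw [hTl, hTx]
  · have hTl : T l x ≠ T j c := by
      simp only [hxc, hxd', hxc', hTx, ne_eq, not_false_eq_true, true_and, false_or,
        true_iff] at e1
      exact e1.1
    revert hTx hTl
    cases T l x <;> cases T j x <;> cases T j c <;> simp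

/-- The `l`-partner `x` of `π j d` is a zero of the row `R j c`. If `x ≠ d`, its side is the same
for `j` and `l`, which leaves only `x = π j c`; but that column is on the wrong side for `l`. -/
theorem pair_step (h : LocalSystem G π T R ρ)
    {j l : Fin k} {c d : Fin n} (hT : T j d = T j c) (hne : d ≠ c)
    {s : ℤˣ} {b : Bool} (hl : G (R j c) (π j d) = .var s b l) : π l (π j d) = d := by
  obtain ⟨h1, h2, h3, h4⟩ := h.side_mirror hT hne hl
  have e1 := (h.form l).zero_pair (π j d)
  rw [h1] at e1
  have e2 : T l (π l (π j d)) = !T j c := by rw [(h.form l).side, h3]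
  generalize π l (π j d) = x at e1 e2
  by_contra hxd
  have hn := (h.form j).ne_zero_iff c x
  simp only [e1, ne_eq, not_true_eq_false, false_iff, not_or, not_and, not_not] at hn
  have hxc' : x ≠ π j c := by
    rintro rfl; rw [h4] at e2; simp at e2
  have hxd' : x ≠ π j d := by
    rintro rfl; rw [h3] at e2; simp at e2
  have hx := h.side_step_other hT hne hl hn.1 hxd hxc' hxd'
  exact hxc' (hn.2 (by rw [← hx, e2]; simp))

theorem pair_step' (h : LocalSystem G π T R ρ)
    {j l : Fin k} {c d : Fin n} (hT : T j d = T j c) (hne : d ≠ c)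
    {s : ℤˣ} {b : Bool} (hl : G (R j c) (π j d) = .var s b l) : π l (π j c) = c := by
  obtain ⟨s', hl'⟩ := h.mirror hT hne hl
  exact h.pair_step hT.symm hne.symm hl'

/-- Let `u` be the indeterminate at column `π j t` of the common row, and `q = π l (π j t)`.
Mirroring in the block of `l` puts `z_u` in column `d` of the row `R l q`, so this is a row of `u`,
and its `u`-support contains `t`. Seen from `l`, columns `t` and `q` are on the same side, so
nonvanishing at `t` forces `t = q`. -/
theorem pair_eq_of_side (h : LocalSystem G π T R ρ)
    {j l : Fin k} {c d : Fin n} (hT : T j d = T j c) (hne : d ≠ c)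
    {s : ℤˣ} {b : Bool} (hl : G (R j c) (π j d) = .var s b l) {t : Fin n} (ht : T j t = T j c)
    (htc : t ≠ c) (htd : t ≠ d) : π l (π j t) = t := by
  have hj := h.form j
  have hll := h.form l
  obtain ⟨h1, h2, h3, h4⟩ := h.side_mirror hT hne hl
  have hpd := h.pair_step hT hne hl
  have hinj : ∀ {i : Fin k} {x y : Fin n}, π i x = π i y → x = y := by
    intro i x y e
    rw [← (h.form i).invol x, e, (h.form i).invol]
  have hside : ∀ {x y : Fin n}, T j x = T j y → x ≠ π j y := by
    rintro x y e rfl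
    rw [hj.side] at e
    simp at e
  -- the indeterminate of the row at the partner of `t`
  obtain ⟨s₁, b₁, u, hu⟩ := Entry.exists_var_of_ne_zero (hj.ne_zero c t ht htc)
  have hut := h.side_step_right ht htc hu
  have hupt := h.pair_step ht htc hu
  have hud : T u d = T j d :=
    h.side_step_other ht htc hu hne htd.symm (hside hT) (hside (hT.trans ht.symm))
  have hlt : T l t = T j t := h.side_step_other hT hne hl htc htd (hside ht)
    (hside (ht.trans hT.symm))
  have hlpt : T l (π j t) = !T j c := by
    rw [h.side_step_other hT hne hl (hside ht.symm).symm
      (hside (hT.trans ht.symm)).symm (fun e => htc (hinj e)) (fun e => htd (hinj e)), hj.side, ht]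
  set q := π l (π j t) with hq
  have hqT : T l q = T l (π j d) := by rw [hq, hll.side, hlpt, h3]; simp
  have hqd : q ≠ π j d := by
    intro e
    have e := congrArg (π l) e
    rw [hq, hll.invol, hpd] at e
    exact hside (hT.trans ht.symm) e.symm
  have hlu : G (R l (π j d)) (π l q) = .var s₁ b₁ u := by rw [h1, hq, hll.invol, hu]
  obtain ⟨s₂, hq2⟩ := h.mirror hqT hqd hlu
  rw [hpd] at hq2
  obtain ⟨hR, -, -⟩ := h.eq_of_var hq2
  have htn : G (R l q) t ≠ 0 := by
    rw [hR, (h.form u).ne_zero_iff]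
    right
    refine ⟨by rw [hut, hud, ht, hT]; simp, ?_⟩
    intro e
    have e := congrArg (π u) e
    rw [(h.form u).invol] at e
    have e3 := congrArg (π u) hupt
    rw [(h.form u).invol] at e3
    exact hside (hT.trans ht.symm) (by rw [← e, ← e3])
  rw [hll.ne_zero_iff] at htn
  rcases htn with e | ⟨e, -⟩
  · exact e.symm
  · exact absurd (by rw [hlt, hqT, h3, ht]) e

/-- Indeterminates that share a row have the same column pairing. -/
theorem pair_eq (h : LocalSystem G π T R ρ)
    {j l : Fin k} {c d : Fin n} (hT : T j d = T j c) (hne : d ≠ c)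
    {s : ℤˣ} {b : Bool} (hl : G (R j c) (π j d) = .var s b l) : π l = π j := by
  have hj := h.form j
  have hside : ∀ x, T j x = T j c → π l (π j x) = x := by
    intro x hx
    by_cases hxc : x = c
    · subst hxc; exact h.pair_step' hT hne hl
    by_cases hxd : x = d
    · subst hxd; exact h.pair_step hT hne hl
    exact h.pair_eq_of_side hT hne hl hx hxc hxd
  funext x
  by_cases hx : T j x = T j c
  · have e := congrArg (π l) (hside x hx)
    rw [(h.form l).invol] at e
    exact e.symm
  · have hx' : T j (π j x) = T j c := by
      rw [hj.side]
      revert hx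
      cases T j x <;> cases T j c <;> simp
    have e := hside _ hx'
    rwa [hj.invol] at e

end LocalSystem

end Pairing

/-! ### Cube vertices of indeterminates and connectedness. -/

section Components

variable {p n k : ℕ}

/-- Two indeterminates share a row. -/
def Shares (G : Design p n k) (j l : Fin k) : Prop :=
  ∃ r c d s b s' b', G r c = .var s b j ∧ G r d = .var s' b' l

/-- Any two indeterminates are linked by a chain of indeterminates sharing rows. -/
def Connected (G : Design p n k) : Prop := ∀ j l, Relation.ReflTransGen (Shares G) j l

namespace LocalSystem

section

variable {G : Design p n k} {π : Fin k → Fin n → Fin n} {T : Fin k → Fin n → Bool}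
    {R : Fin k → Fin n → Fin p} {ρ : Fin k → Fin n → ℤˣ}

theorem eq_or_of_shares (h : LocalSystem G π T R ρ)
    {j l : Fin k} (hs : Shares G j l) : l = j ∨
    ∃ c d s b, T j d = T j c ∧ d ≠ c ∧ G (R j c) (π j d) = .var s b l := by
  obtain ⟨r, c, x, s, b, s', b', h1, h2⟩ := hs
  obtain ⟨rfl, rfl, rfl⟩ := h.eq_of_var h1
  have hx : G (R j c) x ≠ 0 := by rw [h2]; simp
  rw [(h.form j).ne_zero_iff] at hx
  rcases hx with rfl | ⟨hT, hx⟩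
  · left
    rw [h1] at h2
    simp only [Entry.var.injEq] at h2
    exact h2.2.2.symm
  · right
    refine ⟨c, π j x, s', b', ?_, ?_, ?_⟩
    · rw [(h.form j).side]
      revert hT
      cases T j x <;> cases T j c <;> simp
    · intro e
      exact hx (by rw [← e, (h.form j).invol])
    · rw [(h.form j).invol, h2]

theorem pair_eq_of_shares (h : LocalSystem G π T R ρ)
    {j l : Fin k} (hs : Shares G j l) : π l = π j := by
  rcases h.eq_or_of_shares hs with rfl | ⟨c, d, s, b, hT, hne, hl⟩
  · rfl
  · exact h.pair_eq hT hne hl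

theorem pair_eq_of_reaches (h : LocalSystem G π T R ρ)
    {j l : Fin k} (hs : Relation.ReflTransGen (Shares G) j l) :
    π l = π j := by
  induction hs with
  | refl => rfl
  | tail _ hs ih => rw [h.pair_eq_of_shares hs, ih]

theorem mirror_conj (h : LocalSystem G π T R ρ)
    {j l : Fin k} {c x : Fin n} {s : ℤˣ} {b : Bool}
    (hl : G (R j c) x = .var s b l) : ∃ s', G (R j (π j c)) (π j x) = .var s' (!b) l := by
  have hst := (h.form j).star c x
  rw [hl] at hst
  obtain ⟨s', b', l', he⟩ := Entry.exists_var_of_ne_zero (e := G (R j (π j c)) (π j x)) (by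
    intro h0; rw [h0] at hst; simp at hst)
  rw [he] at hst ⊢
  simp only [Entry.smul_var, Entry.star_var, Entry.var.injEq] at hst
  obtain ⟨-, rfl, rfl⟩ := hst
  exact ⟨s', rfl⟩

end

section Labelled

variable {m : ℕ} {G : Design p (2 * m) k} {π : Fin k → Fin (2 * m) → Fin (2 * m)}
    {T : Fin k → Fin (2 * m) → Bool} {R : Fin k → Fin (2 * m) → Fin p}
    {ρ : Fin k → Fin (2 * m) → ℤˣ}

/-- Coordinates on the columns adapted to one indeterminate. -/
theorem exists_columns (h : LocalSystem G π T R ρ)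
    (j : Fin k) : ∃ C : Fin m × Bool ≃ Fin (2 * m),
    (∀ i a, π j (C (i, a)) = C (i, !a)) ∧ ∀ i a, T j (C (i, a)) = !a := by
  have hj := h.form j
  have hc : Fintype.card {c // T j c = false} = m := by
    -- The pairing exchanges the sides, so each has m columns.
    have e : {c // T j c = false} ≃ {c // ¬ T j c = false} :=
      { toFun := fun c => ⟨π j c.1, by rw [hj.side, c.2]; simp⟩
        invFun := fun c => ⟨π j c.1, by rw [hj.side]; simpa using c.2⟩
        left_inv := fun c => Subtype.ext (hj.invol _)
        right_inv := fun c => Subtype.ext (hj.invol _) }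
    have h1 := Fintype.card_congr e
    have h2 := Fintype.card_subtype_compl (fun c => T j c = false)
    have h3 := Fintype.card_subtype_le (fun c => T j c = false)
    rw [Fintype.card_fin] at h2 h3
    omega
  let e : Fin m ≃ {c // T j c = false} := (Fintype.equivFinOfCardEq hc).symm
  let f : Fin m × Bool → Fin (2 * m) := fun q => if q.2 then (e q.1).1 else π j (e q.1).1
  have hT : ∀ i a, T j (f (i, a)) = !a := by
    intro i a
    cases a
    · simp [f, hj.side, (e i).2]
    · simp [f, (e i).2]
  have hp : ∀ i a, π j (f (i, a)) = f (i, !a) := by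
    intro i a
    cases a <;> simp [f, hj.invol]
  have hinj : Function.Injective f := by
    rintro ⟨i, a⟩ ⟨i', a'⟩ hf
    have ha : a = a' := by
      have := congrArg (T j) hf
      rw [hT, hT] at this
      simpa using this
    subst ha
    have ht : f (i, true) = f (i', true) := by
      cases a
      · have := congrArg (π j) hf
        simpa [hp] using this
      · exact hf
    have : e i = e i' := Subtype.ext (by simpa [f] using ht)
    rw [e.injective this]
  have hbij : Function.Bijective f := by
    rw [Fintype.bijective_iff_injective_and_card]
    exact ⟨hinj, by simp [mul_comm]⟩
  exact ⟨Equiv.ofBijective f hbij, hp, hT⟩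

/-- The vertex of the cube attached to an indeterminate. -/
def vertex (T : Fin k → Fin (2 * m) → Bool) (C : Fin m × Bool ≃ Fin (2 * m)) (j : Fin k) :
    Fin m → Bool := fun i => T j (C (i, true))

variable {C : Fin m × Bool ≃ Fin (2 * m)}

theorem side_column (h : LocalSystem G π T R ρ)
    {j : Fin k} (hC : ∀ i a, π j (C (i, a)) = C (i, !a)) (i : Fin m) (a : Bool) :
    T j (C (i, a)) = !(xor a (vertex T C j i)) := by
  cases a
  · have := (h.form j).side (C (i, true))
    rw [hC] at this
    simpa [vertex] using this
  · simp [vertex]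

theorem side_column_not (h : LocalSystem G π T R ρ)
    {j : Fin k} (hC : ∀ i a, π j (C (i, a)) = C (i, !a)) (i : Fin m) :
    T j (C (i, !vertex T C j i)) = false := by
  rw [h.side_column hC]; simp

/-- The side is reversed on the pairs of the two columns involved and is unchanged on all others,
which is a double flip. -/
theorem vertex_step (h : LocalSystem G π T R ρ)
    {j l : Fin k} (hC : ∀ i a, π j (C (i, a)) = C (i, !a)) {i t : Fin m}
    {a a' : Bool} (hit : i ≠ t) (hT : T j (C (t, a')) = T j (C (i, a))) {s : ℤˣ} {b : Bool}
    (hl : G (R j (C (i, a))) (π j (C (t, a'))) = .var s b l) :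
    vertex T C l = flip (flip (vertex T C j) i) t := by
  have hne : C (t, a') ≠ C (i, a) := by
    intro e
    exact hit (congrArg Prod.fst (C.injective e)).symm
  have hπ := h.pair_eq hT hne hl
  have h1 := h.side_step_left hT hne hl
  have h2 := h.side_step_right hT hne hl
  have hCl : ∀ i a, π l (C (i, a)) = C (i, !a) := by rw [hπ]; exact hC
  rw [h.side_column hC, h.side_column hCl] at h1 h2
  funext q
  by_cases hqt : q = t
  · subst hqt
    rw [flip_same, flip_of_ne _ (Ne.symm hit)]
    revert h2
    cases a' <;> cases vertex T C l q <;> cases vertex T C j q <;> simp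
  rw [flip_of_ne _ hqt]
  by_cases hqi : q = i
  · subst hqi
    rw [flip_same]
    revert h1
    cases a <;> cases vertex T C l q <;> cases vertex T C j q <;> simp
  rw [flip_of_ne _ hqi]
  refine h.side_step_other hT hne hl ?_ ?_ ?_ ?_ <;> try rw [hC]
  all_goals
    intro e
    have := congrArg Prod.fst (C.injective e)
    first
      | exact hqi this
      | exact hqt this

/-- A nonempty set of indeterminates that is closed under sharing rows has at least as many
elements as the cube has even vertices. -/
theorem exists_injective_of_closed (h : LocalSystem G π T R ρ)
    {K : Set (Fin k)}
    (hK : ∀ j l, j ∈ K → Shares G j l → l ∈ K) {j₀ : Fin k} (hj₀ : j₀ ∈ K) :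
    ∃ g : EvenVertex m → Fin k, Function.Injective g ∧ ∀ y, g y ∈ K := by
  obtain ⟨C, hC, hT₀⟩ := h.exists_columns j₀
  have hv₀ : vertex T C j₀ = fun _ => false := by
    funext i; simp [vertex, hT₀]
  have key : ∀ y : EvenVertex m, ∃ j, (j ∈ K ∧ π j = π j₀) ∧ vertex T C j = y.1 := by
    intro y
    -- Off-diagonal entries of the blocks are nonzero, so from any indeterminate of `K` every double
    -- flip is realized by one sharing a row with it.
    refine mem_of_double_flip_closed (vertex T C '' {j | j ∈ K ∧ π j = π j₀})
      ⟨j₀, ⟨hj₀, rfl⟩, rfl⟩ ?_ ?_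
    · rintro _ i t hit ⟨j, ⟨hjK, hjπ⟩, rfl⟩
      have hCj : ∀ i a, π j (C (i, a)) = C (i, !a) := by rw [hjπ]; exact hC
      have hTT : T j (C (t, !vertex T C j t)) = T j (C (i, !vertex T C j i)) := by
        rw [h.side_column_not hCj, h.side_column_not hCj]
      have hne : C (t, !vertex T C j t) ≠ C (i, !vertex T C j i) := by
        intro e
        exact hit (congrArg Prod.fst (C.injective e)).symm
      obtain ⟨s, b, l, hl⟩ := Entry.exists_var_of_ne_zero ((h.form j).ne_zero _ _ hTT hne)
      refine ⟨l, ⟨hK j l hjK ⟨_, _, _, _, _, _, _, (h.form j).diag _, hl⟩, ?_⟩,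
        h.vertex_step hCj hit hTT hl⟩
      rw [h.pair_eq hTT hne hl, hjπ]
    · rw [y.2, hv₀]; simp [parity]
  choose g hg hgv using key
  refine ⟨g, fun y y' e => Subtype.ext ?_, fun y => (hg y).1⟩
  rw [← hgv, ← hgv, e]

end Labelled

end LocalSystem

/-- There are exactly as many indeterminates as even vertices, so the injection of even vertices
into `K` is onto. -/
theorem IsBCOD.eq_univ_of_closed {m : ℕ} (hm : 1 ≤ m) {G : Design p (2 * m) (2 ^ (m - 1))}
    (hG : IsBCOD G) {K : Set (Fin (2 ^ (m - 1)))}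
    (hK : ∀ j l, j ∈ K → Shares G j l → l ∈ K) {j₀ : Fin (2 ^ (m - 1))} (hj₀ : j₀ ∈ K)
    (l : Fin (2 ^ (m - 1))) : l ∈ K := by
  obtain ⟨π, T, R, ρ, h⟩ := hG.exists_localSystem
  obtain ⟨g, hg, hgK⟩ := h.exists_injective_of_closed hK hj₀
  have hbij : Function.Bijective g := by
    rw [Fintype.bijective_iff_injective_and_card]
    exact ⟨hg, by rw [card_even hm, Fintype.card_fin]⟩
  obtain ⟨y, rfl⟩ := hbij.2 l
  exact hgK y

theorem IsBCOD.connected {m : ℕ} (hm : 1 ≤ m) {G : Design p (2 * m) (2 ^ (m - 1))}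
    (hG : IsBCOD G) : Connected G := fun j =>
  hG.eq_univ_of_closed hm (K := {l | Relation.ReflTransGen (Shares G) j l})
    (fun _ _ h1 h2 => h1.tail h2) Relation.ReflTransGen.refl

end Components

/-! ### The model design and uniqueness of its edge signs. -/

section Model

variable {p m k : ℕ}

/-- `G` is, up to the names of rows, columns and indeterminates and the signs of rows and
indeterminates, the standard design of the cube. -/
def Modelled (G : Design p (2 * m) k) : Prop :=
  ∃ (A : OddVertex m × Bool ≃ Fin p) (C : Fin m × Bool ≃ Fin (2 * m)) (V : EvenVertex m ≃ Fin k)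
    (ρ : OddVertex m × Bool → ℤˣ) (η : EvenVertex m → ℤˣ), ∀ x b i a,
    G (A (x, b)) (C (i, a)) = if a = xor (x.1 i) b then
      .var (ρ (x, b) * η (x.flip i) * cubeSign x.1 i) b (V (x.flip i)) else 0

/-- A sign on the edges of the cube, given by its values at odd vertices, with product `-1`
around every square is the standard sign up to signs of the vertices. -/
theorem exists_sign_of_square (ε : OddVertex m → Fin m → ℤˣ)
    (hε : ∀ x i s, i ≠ s →
      ε x i * ε x s = -(ε ((x.flip i).flip s) i * ε ((x.flip i).flip s) s)) :
    ∃ θ : (Fin m → Bool) → ℤˣ, ∀ x i, ε x i = θ x.1 * θ (flip x.1 i) * cubeSign x.1 i := by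
  classical
  -- The ratio of `ε` to the standard sign, read from the odd end of the edge; the last branch never
  -- occurs.
  let δ : (Fin m → Bool) → Fin m → ℤˣ := fun x i =>
    if hx : parity x = 1 then ε ⟨x, hx⟩ i * cubeSign x i
    else if hy : parity (flip x i) = 1 then ε ⟨flip x i, hy⟩ i * cubeSign x i else 1
  have hodd : ∀ (x : OddVertex m) i, δ x.1 i = ε x i * cubeSign x.1 i := by
    intro x i; simp only [δ, x.2, dif_pos]
  have heven : ∀ (x : EvenVertex m) i, δ x.1 i = ε (x.flip i) i * cubeSign x.1 i := by
    intro x i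
    have h0 : ¬ parity x.1 = 1 := by rw [x.2]; decide
    have h1 : parity (flip x.1 i) = 1 := (x.flip i).2
    simp only [δ, dif_neg h0, dif_pos h1]
    rfl
  have hsolve : ∀ a b c d : ℤˣ, a * b = -(c * d) → a = -(b * c * d) := by
    intro a b c d e
    rw [← mul_one a, ← Int.units_mul_self b, ← mul_assoc, e, neg_mul]
    congr 1
    ac_rfl
  obtain ⟨θ, hθ⟩ := exists_vertex_sign δ (by
    intro x i
    rcases parity_cases x with hx | hx
    · obtain ⟨y, rfl⟩ : ∃ y : EvenVertex m, y.1 = x := ⟨⟨x, hx⟩, rfl⟩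
      have e2 := hodd (y.flip i) i
      change δ (flip y.1 i) i = _ * cubeSign (flip y.1 i) i at e2
      rw [heven, e2, cubeSign_flip_of_le _ le_rfl]
    · obtain ⟨y, rfl⟩ : ∃ y : OddVertex m, y.1 = x := ⟨⟨x, hx⟩, rfl⟩
      have e2 := heven (y.flip i) i
      change δ (flip y.1 i) i = _ * cubeSign (flip y.1 i) i at e2
      rw [hodd, e2, cubeSign_flip_of_le _ le_rfl, OddVertex.flip_flip]) (by
    intro x i s
    by_cases his : i = s
    · rw [his]
    have h2 := hsolve _ _ _ _ (cubeSign_square_edges x his)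
    rcases parity_cases x with hx | hx
    · obtain ⟨y, rfl⟩ : ∃ y : EvenVertex m, y.1 = x := ⟨⟨x, hx⟩, rfl⟩
      have e2 := hodd (y.flip i) s
      have e4 := hodd (y.flip s) i
      change δ (flip y.1 i) s = _ * cubeSign (flip y.1 i) s at e2
      change δ (flip y.1 s) i = _ * cubeSign (flip y.1 s) i at e4
      have h1 := hsolve _ _ _ _ (hε (y.flip i) i s his)
      rw [EvenVertex.flip_flip] at h1
      rw [heven, heven, e2, e4, h1, h2]
      have c1 := Int.units_mul_self (ε (y.flip i) s)
      have c2 := Int.units_mul_self (cubeSign (flip y.1 i) s)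
      generalize ε (y.flip i) s = a at *
      generalize cubeSign (flip y.1 i) s = b at *
      generalize ε (y.flip s) i = c
      generalize ε (y.flip s) s = d
      generalize cubeSign y.1 s = f
      generalize cubeSign (flip y.1 s) i = g
      calc _ = c * d * f * g * (a * a) * (b * b) := by
            simp only [neg_mul, mul_neg, neg_neg]; ac_rfl
        _ = _ := by rw [c1, c2, mul_one, mul_one]; ac_rfl
    · obtain ⟨y, rfl⟩ : ∃ y : OddVertex m, y.1 = x := ⟨⟨x, hx⟩, rfl⟩
      have e2 := heven (y.flip i) s
      have e4 := heven (y.flip s) i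
      change δ (flip y.1 i) s = _ * cubeSign (flip y.1 i) s at e2
      change δ (flip y.1 s) i = _ * cubeSign (flip y.1 s) i at e4
      have h1 := hsolve _ _ _ _ (hε y i s his)
      have hf : (y.flip s).flip i = (y.flip i).flip s := Subtype.ext (flip_comm _ _ _)
      rw [hodd, hodd, e2, e4, hf, h1, h2]
      have c1 := Int.units_mul_self (ε ((y.flip i).flip s) s)
      have c2 := Int.units_mul_self (cubeSign (flip y.1 i) s)
      generalize ε ((y.flip i).flip s) s = a at *
      generalize cubeSign (flip y.1 i) s = b at *
      generalize ε y s = c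
      generalize ε ((y.flip i).flip s) i = d
      generalize cubeSign y.1 s = f
      generalize cubeSign (flip y.1 s) i = g
      calc _ = c * d * f * g * (a * a) * (b * b) := by
            simp only [neg_mul, mul_neg, neg_neg]; ac_rfl
        _ = _ := by rw [c1, c2, mul_one, mul_one]; ac_rfl)
  refine ⟨θ, fun x i => ?_⟩
  rw [← hθ, hodd, mul_assoc, Int.units_mul_self, mul_one]

end Model

/-! ### Connected BCODs are modelled on the cube. -/

section Classification

variable {p m k : ℕ}

namespace LocalSystem

variable {G : Design p (2 * m) k} {π : Fin k → Fin (2 * m) → Fin (2 * m)}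
    {T : Fin k → Fin (2 * m) → Bool} {R : Fin k → Fin (2 * m) → Fin p}
    {ρ : Fin k → Fin (2 * m) → ℤˣ} {C : Fin m × Bool ≃ Fin (2 * m)}

/-- The unconjugated row containing an indeterminate in a given direction. -/
def rowAt (T : Fin k → Fin (2 * m) → Bool) (R : Fin k → Fin (2 * m) → Fin p)
    (C : Fin m × Bool ≃ Fin (2 * m)) (j : Fin k) (i : Fin m) : Fin p :=
  R j (C (i, !vertex T C j i))

/-- The row has one nonzero column in each direction, and these columns spell out the vertex next to
that of `j` in direction `i`. -/
theorem rowAt_ne_zero_iff (h : LocalSystem G π T R ρ)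
    (hC : ∀ j i a, π j (C (i, a)) = C (i, !a))
    (j : Fin k) (i t : Fin m) (a : Bool) :
    G (rowAt T R C j i) (C (t, a)) ≠ 0 ↔ a = flip (vertex T C j) i t := by
  rw [rowAt, (h.form j).ne_zero_iff, h.side_column (hC j), h.side_column (hC j), hC,
    C.injective.eq_iff, C.injective.ne_iff]
  by_cases hti : t = i
  · subst hti
    simp
  · rw [flip_of_ne _ hti]
    simp [hti]

theorem rowAt_var_unique (h : LocalSystem G π T R ρ)
    (hC : ∀ j i a, π j (C (i, a)) = C (i, !a))
    {j : Fin k} {i t : Fin m} {a a' : Bool} {s s' : ℤˣ} {b b' : Bool}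
    {l l' : Fin k} (h1 : G (rowAt T R C j i) (C (t, a)) = .var s b l)
    (h2 : G (rowAt T R C j i) (C (t, a')) = .var s' b' l') : l = l' := by
  have e1 := (h.rowAt_ne_zero_iff hC j i t a).1 (by rw [h1]; simp)
  have e2 := (h.rowAt_ne_zero_iff hC j i t a').1 (by rw [h2]; simp)
  rw [e1] at h1
  rw [e2, h1] at h2
  simp only [Entry.var.injEq] at h2
  exact h2.2.2

theorem exists_rowAt_var (h : LocalSystem G π T R ρ)
    (hC : ∀ j i a, π j (C (i, a)) = C (i, !a))
    (j : Fin k) (i t : Fin m) :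
    ∃ l s, G (rowAt T R C j i) (C (t, flip (vertex T C j) i t)) = .var s false l := by
  obtain ⟨s, b, l, hl⟩ := Entry.exists_var_of_ne_zero
    ((h.rowAt_ne_zero_iff hC j i t _).2 rfl)
  have hb := h.conj_eq hl
  rw [h.side_column_not (hC j)] at hb
  subst hb
  exact ⟨l, s, hl⟩

theorem rowAt_eq (h : LocalSystem G π T R ρ)
    (hC : ∀ j i a, π j (C (i, a)) = C (i, !a))
    {r : Fin p} {l : Fin k} {t : Fin m} {a : Bool} {s : ℤˣ}
    (hl : G r (C (t, a)) = .var s false l) : r = rowAt T R C l t ∧ a = !vertex T C l t := by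
  obtain ⟨h1, -, h2⟩ := h.eq_of_var hl
  rw [h.side_column (hC l)] at h2
  have ha : a = !vertex T C l t := by
    revert h2
    cases a <;> cases vertex T C l t <;> simp
  exact ⟨by rw [h1, ha]; rfl, ha⟩

/-- The indeterminates and the unconjugated rows are the vertices of a cube. -/
theorem exists_cube (h : LocalSystem G π T R ρ)
    (hC : ∀ j i a, π j (C (i, a)) = C (i, !a))
    (j₀ : Fin k) (hv : vertex T C j₀ = fun _ => false) :
    ∃ (V : EvenVertex m → Fin k) (A : OddVertex m → Fin p),
      (∃ y, V y = j₀) ∧ (∀ y, vertex T C (V y) = y.1) ∧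
      (∀ y i, A (y.flip i) = rowAt T R C (V y) i) ∧
      ∀ x i, ∃ s, G (A x) (C (i, x.1 i)) = .var s false (V (x.flip i)) := by
  classical
  have hE : ∀ (r : Fin p) (t : Fin m), ∃ l : Fin k, (∃ j i, r = rowAt T R C j i) →
      ∃ a s, G r (C (t, a)) = .var s false l := by
    intro r t
    by_cases hr : ∃ j i, r = rowAt T R C j i
    · obtain ⟨j, i, rfl⟩ := hr
      obtain ⟨l, s, hl⟩ := h.exists_rowAt_var hC j i t
      exact ⟨l, fun _ => ⟨_, s, hl⟩⟩
    · exact ⟨j₀, fun h => absurd h hr⟩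
  choose E hE using hE
  have hEeq : ∀ {j i t a s b l}, G (rowAt T R C j i) (C (t, a)) = .var s b l →
      E (rowAt T R C j i) t = l := by
    intro j i t a s b l hl
    obtain ⟨a', s', hl'⟩ := hE (rowAt T R C j i) t ⟨j, i, rfl⟩
    exact h.rowAt_var_unique hC hl' hl
  have hErow : ∀ r t, (∃ j i, r = rowAt T R C j i) → rowAt T R C (E r t) t = r := by
    intro r t hr
    obtain ⟨a, s, hl⟩ := hE r t hr
    exact (h.rowAt_eq hC hl).1.symm
  have hEself : ∀ j i, E (rowAt T R C j i) i = j := fun j i => hEeq ((h.form j).diag _)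
  -- Mirror positions of a skew block hold the same indeterminate.
  have hEcomm : ∀ j i t, E (rowAt T R C j i) t = E (rowAt T R C j t) i := by
    intro j i t
    by_cases hit : i = t
    · rw [hit]
    have hTT : T j (C (t, !vertex T C j t)) = T j (C (i, !vertex T C j i)) := by
      rw [h.side_column_not (hC j), h.side_column_not (hC j)]
    have hne : C (t, !vertex T C j t) ≠ C (i, !vertex T C j i) := by
      intro e
      exact hit (congrArg Prod.fst (C.injective e)).symm
    obtain ⟨s, b, l, hl⟩ := Entry.exists_var_of_ne_zero ((h.form j).ne_zero _ _ hTT hne)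
    obtain ⟨s', hl'⟩ := h.mirror hTT hne hl
    rw [hC] at hl hl'
    rw [hEeq hl, hEeq hl']
  obtain ⟨Ψ, hΨ0, hΨP, hΨ⟩ := exists_cube_map (X := Fin p ⊕ Fin k)
    (fun x => ∀ r, x = Sum.inl r → ∃ j i, r = rowAt T R C j i)
    (fun i x => Sum.elim (fun r => Sum.inr (E r i)) (fun j => Sum.inl (rowAt T R C j i)) x)
    (by
      rintro i (r | j) hx q hq
      · simp at hq
      · simp only [Sum.elim_inr, Sum.inl.injEq] at hq
        exact ⟨j, i, hq.symm⟩)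
    (by
      rintro i (r | j) hx
      · simp [hErow r i (hx r rfl)]
      · simp [hEself])
    (by
      rintro i t (r | j) hx
      · simp only [Sum.elim_inl, Sum.elim_inr, Sum.inl.injEq]
        have hr := hErow r i (hx r rfl)
        conv_lhs => rw [← hr]
        rw [hEcomm, hErow _ _ ⟨_, _, rfl⟩]
      · simp [hEcomm j t i])
    (Sum.inr j₀) (by simp)
  have key : ∀ x, (parity x = 0 ∧ ∃ j, Ψ x = Sum.inr j ∧ vertex T C j = x) ∨
      (parity x = 1 ∧ ∃ r, Ψ x = Sum.inl r ∧ ∀ i a, G r (C (i, a)) ≠ 0 → a = x i) := by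
    refine flip_induction _ (x₀ := fun _ => false) (Or.inl ⟨by simp [parity], j₀, hΨ0, hv⟩) ?_
    rintro x i (⟨hx, j, hj, hjx⟩ | ⟨hx, r, hr, hrx⟩)
    · right
      refine ⟨by rw [parity_flip, hx]; rfl, rowAt T R C j i, by rw [hΨ, hj]; rfl, ?_⟩
      intro t a hta
      rw [(h.rowAt_ne_zero_iff hC j i t a).1 hta, hjx]
    · left
      refine ⟨by rw [parity_flip, hx]; rfl, E r i, by rw [hΨ, hr]; rfl, ?_⟩
      have hrow := hErow r i (hΨP x r hr)
      have hxe : flip (vertex T C (E r i)) i = x := by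
        funext t
        refine hrx t _ ?_
        have := (h.rowAt_ne_zero_iff hC (E r i) i t _).2 rfl
        rwa [hrow] at this
      rw [← hxe, flip_flip]
  have hV : ∀ y : EvenVertex m, ∃ j, Ψ y.1 = Sum.inr j ∧ vertex T C j = y.1 := by
    intro y
    rcases key y.1 with ⟨-, hk⟩ | ⟨h1, -⟩
    · exact hk
    · rw [y.2] at h1; exact absurd h1 (by decide)
  have hA : ∀ x : OddVertex m, ∃ r, Ψ x.1 = Sum.inl r ∧
      ∀ i a, G r (C (i, a)) ≠ 0 → a = x.1 i := by
    intro x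
    rcases key x.1 with ⟨h1, -⟩ | ⟨-, hk⟩
    · rw [x.2] at h1; exact absurd h1 (by decide)
    · exact hk
  choose V hVΨ hVv using hV
  choose A hAΨ hAs using hA
  refine ⟨V, A, ⟨⟨fun _ => false, by simp [parity]⟩, ?_⟩, hVv, ?_, ?_⟩
  · have := hVΨ ⟨fun _ => false, by simp [parity]⟩
    rw [hΨ0] at this
    exact (Sum.inr_injective this).symm
  · intro y i
    have h1 := hAΨ (y.flip i)
    change Ψ (flip y.1 i) = _ at h1
    rw [hΨ, hVΨ] at h1
    exact (Sum.inl_injective h1).symm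
  · intro x i
    have h1 := hVΨ (x.flip i)
    change Ψ (flip x.1 i) = _ at h1
    rw [hΨ, hAΨ] at h1
    have h2 : E (A x) i = V (x.flip i) := Sum.inr_injective h1
    obtain ⟨a, s, hl⟩ := hE (A x) i (hΨP x.1 _ (hAΨ x))
    have ha := hAs x i a (by rw [hl]; simp)
    rw [ha, h2] at hl
    exact ⟨s, hl⟩

/-- If the common row is conjugated, the `star` relation supplies an unconjugated one. -/
theorem exists_rowAt_of_shares (h : LocalSystem G π T R ρ)
    (hC : ∀ j i a, π j (C (i, a)) = C (i, !a))
    {j l : Fin k} (hs : Shares G j l) :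
    l = j ∨ ∃ i t a s, G (rowAt T R C j i) (C (t, a)) = .var s false l := by
  rcases h.eq_or_of_shares hs with rfl | ⟨c, d, s, b, hT, hne, hl⟩
  · exact Or.inl rfl
  right
  have key : ∀ c x s b, T j c = false → G (R j c) x = .var s b l →
      ∃ i t a s, G (rowAt T R C j i) (C (t, a)) = .var s false l := by
    intro c x s b hc hx
    obtain ⟨⟨i, a⟩, rfl⟩ := C.surjective c
    obtain ⟨⟨t, a'⟩, rfl⟩ := C.surjective x
    have hb := h.conj_eq hx
    rw [hc] at hb
    subst hb
    refine ⟨i, t, a', s, ?_⟩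
    rw [h.side_column (hC j)] at hc
    have ha : a = !vertex T C j i := by
      revert hc
      cases a <;> cases vertex T C j i <;> simp
    rw [ha] at hx
    exact hx
  cases hc : T j c
  · exact key c _ s b hc hl
  · obtain ⟨s', hl'⟩ := h.mirror_conj hl
    exact key (π j c) _ s' _ (by rw [(h.form j).side, hc]; rfl) hl'

/-- Vertices separate the indeterminates given by `V`, and connectedness makes `V` onto, since every
indeterminate in a row of the cube is again a value of `V`. Every row of `G` is nonzero, hence is a
cube row or its conjugate. -/
theorem modelled (h : LocalSystem G π T R ρ)
    (hC : ∀ j i a, π j (C (i, a)) = C (i, !a))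
    (hm : 1 ≤ m) (hconn : Connected G) (hrow : ∀ r, ∃ c, G r c ≠ 0)
    (j₀ : Fin k) (hv : vertex T C j₀ = fun _ => false) : Modelled G := by
  obtain ⟨V, A, ⟨y₀, hy₀⟩, hVv, hAV, hGA⟩ := h.exists_cube hC j₀ hv
  have hAR : ∀ x i, A x = rowAt T R C (V (x.flip i)) i := by
    intro x i
    rw [← hAV, OddVertex.flip_flip]
  have hcol : ∀ (x : OddVertex m) i, (!vertex T C (V (x.flip i)) i) = x.1 i := by
    intro x i
    rw [hVv]
    change (!flip x.1 i i) = _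
    simp
  have hAR' : ∀ x i, A x = R (V (x.flip i)) (C (i, x.1 i)) := by
    intro x i
    rw [hAR x i, rowAt, hcol]
  have hVinj : Function.Injective V := fun y y' e => Subtype.ext (by rw [← hVv, ← hVv, e])
  have hVsurj : Function.Surjective V := by
    intro l
    have hl := hconn j₀ l
    induction hl with
    | refl => exact ⟨y₀, hy₀⟩
    | tail _ hs ih =>
      obtain ⟨y, rfl⟩ := ih
      rcases h.exists_rowAt_of_shares hC hs with rfl | ⟨i, t, a, s, hl⟩
      · exact ⟨y, rfl⟩
      · obtain ⟨s', hl'⟩ := hGA (y.flip i) t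
        rw [hAV] at hl'
        exact ⟨_, h.rowAt_var_unique hC hl' hl⟩
  let ε : OddVertex m → Fin m → ℤˣ := fun x i => ρ (V (x.flip i)) (C (i, x.1 i))
  have hG0 : ∀ x i, G (A x) (C (i, x.1 i)) = .var (ε x i) false (V (x.flip i)) := by
    intro x i
    obtain ⟨s, hl⟩ := hGA x i
    rw [hl, (h.eq_of_var hl).2.1]
  let i₀ : Fin m := ⟨0, hm⟩
  have hG0' : ∀ x i a, G (A x) (C (i, a)) =
      if a = x.1 i then .var (ε x i) false (V (x.flip i)) else 0 := by
    intro x i a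
    split_ifs with ha
    · rw [ha, hG0]
    · by_contra hne
      rw [hAR x i, ← ne_eq, h.rowAt_ne_zero_iff hC] at hne
      apply ha
      rw [hne, hVv]
      change flip (flip x.1 i) i i = _
      rw [flip_flip]
  -- The conjugate of row `x`, found through the partner column in direction `i₀`; the `star`
  -- relation makes all its entries conjugates up to the common sign `τ x`.
  let A₁ : OddVertex m → Fin p := fun x => R (V (x.flip i₀)) (C (i₀, !x.1 i₀))
  let τ : OddVertex m → ℤˣ := fun x => ρ (V (x.flip i₀)) (C (i₀, !x.1 i₀)) * ε x i₀
  have hG1 : ∀ x i a, G (A₁ x) (C (i, a)) =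
      if a = !x.1 i then .var (τ x * ε x i) true (V (x.flip i)) else 0 := by
    intro x i a
    have hst := (h.form (V (x.flip i₀))).star (C (i₀, x.1 i₀)) (C (i, !a))
    rw [hC, hC, ← hAR', Bool.not_not, hG0', Entry.star_smul_entry] at hst
    have hst' := congrArg (ρ (V (x.flip i₀)) (C (i₀, !x.1 i₀)) • ·) hst
    simp only [Entry.smul_smul_self] at hst'
    change G (A₁ x) (C (i, a)) = _ at hst'
    rw [hst', smul_smul]
    change τ x • _ = _
    by_cases ha : a = !x.1 i
    · rw [if_pos ha, if_pos (by rw [ha]; simp)]; rfl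
    · rw [if_neg ha, if_neg (by intro e; exact ha (by rw [← e]; simp))]; rfl
  let A₂ : OddVertex m × Bool → Fin p := fun q => if q.2 then A₁ q.1 else A q.1
  let σ : OddVertex m × Bool → ℤˣ := fun q => if q.2 then τ q.1 else 1
  have hG2 : ∀ x b i a, G (A₂ (x, b)) (C (i, a)) =
      if a = xor (x.1 i) b then .var (σ (x, b) * ε x i) b (V (x.flip i)) else 0 := by
    intro x b i a
    cases b
    · simpa [A₂, σ] using hG0' x i a
    · simpa [A₂, σ] using hG1 x i a
  have hA₂inj : Function.Injective A₂ := by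
    rintro ⟨x, b⟩ ⟨x', b'⟩ e
    have hx : ∀ i, xor (x.1 i) b = xor (x'.1 i) b' ∧ b = b' := by
      intro i
      have e1 := hG2 x b i (xor (x.1 i) b)
      rw [if_pos rfl, e, hG2] at e1
      split_ifs at e1 with hif
      simp only [Entry.var.injEq] at e1
      exact ⟨hif, e1.2.1.symm⟩
    obtain rfl := (hx i₀).2
    have : x = x' := Subtype.ext (by funext i; simpa using (hx i).1)
    rw [this]
  have hA₂surj : Function.Surjective A₂ := by
    intro r
    obtain ⟨c, hc⟩ := hrow r
    obtain ⟨⟨i, a⟩, rfl⟩ := C.surjective c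
    obtain ⟨s, b, j, hj⟩ := Entry.exists_var_of_ne_zero hc
    obtain ⟨y, rfl⟩ := hVsurj j
    have hb := (h.eq_of_var hj).2.2
    rw [h.side_column (hC _), hVv] at hb
    have h2 := hG2 (y.flip i) b i a
    have hyi : (y.flip i).1 i = !y.1 i := flip_same _ _
    rw [if_pos (by rw [hyi, hb]; cases a <;> cases y.1 i <;> rfl), EvenVertex.flip_flip] at h2
    exact ⟨_, h.unique h2 hj⟩
  -- Rows `x` and `x'` are mirror rows in the block of the indeterminate at `x.flip i`; comparing
  -- signs in its skew relation gives the square.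
  have hε : ∀ x i s, i ≠ s →
      ε x i * ε x s = -(ε ((x.flip i).flip s) i * ε ((x.flip i).flip s) s) := by
    intro x i s his
    set x' := (x.flip i).flip s with hx'
    have hx's : x'.flip s = x.flip i := EvenVertex.flip_flip _ _
    have v1 : x'.1 s = !x.1 s := by
      change flip (flip x.1 i) s s = _
      rw [flip_same, flip_of_ne _ his.symm]
    have v2 : x'.1 i = !x.1 i := by
      change flip (flip x.1 i) s i = _
      rw [flip_of_ne _ his, flip_same]
    have hT1 : T (V (x.flip i)) (C (i, x.1 i)) = false := by
      rw [← hcol x i, h.side_column_not (hC _)]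
    have hT2 : T (V (x.flip i)) (C (s, !x.1 s)) = false := by
      rw [← hx's, ← v1, ← hcol x' s, h.side_column_not (hC _)]
    have hsk := (h.form (V (x.flip i))).skew (C (i, x.1 i)) (C (s, !x.1 s))
      (by rw [hT1, hT2]) (by
        intro e
        exact his (congrArg Prod.fst (C.injective e)).symm)
    rw [hC, hC, Bool.not_not, ← hAR', hG0] at hsk
    have hR' : R (V (x.flip i)) (C (s, !x.1 s)) = A x' := by
      rw [hAR' x' s, hx's, v1]
    have hρ' : ρ (V (x.flip i)) (C (s, !x.1 s)) = ε x' s := by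
      simp only [ε]
      rw [hx's, v1]
    rw [hR', ← v2, hG0, hρ'] at hsk
    simp only [Entry.smul_var, Entry.neg_var, Entry.var.injEq] at hsk
    rw [mul_comm (ε x' i)]
    exact hsk.1
  obtain ⟨θ, hθ⟩ := exists_sign_of_square ε hε
  refine ⟨Equiv.ofBijective A₂ ⟨hA₂inj, hA₂surj⟩, C, Equiv.ofBijective V ⟨hVinj, hVsurj⟩,
    fun q => σ q * θ q.1.1, fun y => θ y.1, ?_⟩
  intro x b i a
  change G (A₂ (x, b)) (C (i, a)) = _
  rw [hG2, hθ]
  simp only [mul_assoc]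
  rfl

end LocalSystem

theorem IsBCOD.modelled (hm : 1 ≤ m) {G : Design p (2 * m) k} (hG : IsBCOD G)
    (hconn : Connected G) : Modelled G := by
  obtain ⟨π, T, R, ρ, h⟩ := hG.exists_localSystem
  let j₀ : Fin k := ⟨0, hG.isCOD.1⟩
  obtain ⟨C, hC, hT⟩ := h.exists_columns j₀
  refine h.modelled (C := C) (fun j => ?_) hm hconn (fun r => ?_) j₀ ?_
  · rw [h.pair_eq_of_reaches (hconn j₀ j)]
    exact hC
  · have hr := hG.card_nonzero r
    obtain ⟨c, hc⟩ := Finset.card_pos.1 (by rw [hr]; exact hm)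
    exact ⟨c, (Finset.mem_filter.1 hc).2⟩
  · funext i; simp [LocalSystem.vertex, hT]

end Classification

/-! ### Realizing relabellings and sign changes by operations. -/

section Transformations

variable {p n k : ℕ}

theorem TransformsTo.trans {allowed : Op p n k → Prop} {G H K : Design p n k}
    (h₁ : TransformsTo allowed G H) (h₂ : TransformsTo allowed H K) : TransformsTo allowed G K :=
  Relation.ReflTransGen.trans h₁ h₂

theorem TransformsTo.of_op {allowed : Op p n k → Prop} (G : Design p n k) {o : Op p n k}
    (ho : allowed o) : TransformsTo allowed G (o.apply G) :=
  Relation.ReflTransGen.single ⟨o, ho, rfl⟩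

theorem TransformsTo.mono {allowed allowed' : Op p n k → Prop} (h : ∀ o, allowed o → allowed' o)
    {G H : Design p n k} (hGH : TransformsTo allowed G H) : TransformsTo allowed' G H := by
  induction hGH with
  | refl => exact Relation.ReflTransGen.refl
  | tail _ hs ih =>
    obtain ⟨o, ho, e⟩ := hs
    exact Relation.ReflTransGen.tail ih ⟨o, h o ho, e⟩

theorem EquivalentWithoutColNeg.equivalent {G H : Design p n k}
    (h : EquivalentWithoutColNeg G H) : Equivalent G H :=
  TransformsTo.mono (fun _ _ => trivial) h

/-- Row negations realize all changes of the signs of the rows. -/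
theorem transformsTo_row_signs {allowed : Op p n k → Prop} (ha : ∀ r, allowed (.rowNeg r))
    (G : Design p n k) (ρ : Fin p → ℤˣ) :
    TransformsTo allowed G (Matrix.of fun r c => ρ r • G r c) := by
  classical
  have key : ∀ F : Finset (Fin p),
      TransformsTo allowed G (Matrix.of fun r c => (if r ∈ F then ρ r else 1) • G r c) := by
    intro F
    induction F using Finset.induction_on with
    | empty =>
      simp only [Finset.notMem_empty, if_false, one_smul]
      exact Relation.ReflTransGen.refl
    | insert q F hq ih =>
      rcases Int.units_eq_one_or (ρ q) with h1 | h1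
      · convert ih using 5 with r c
        by_cases hr : r = q
        · subst hr; simp [h1]
        · simp [hr]
      · convert ih.trans (TransformsTo.of_op _ (ha q)) using 1
        ext r c
        by_cases hr : r = q
        · subst hr; simp [h1, Op.apply, hq, Entry.neg_one_smul_entry]
        · simp [hr, Op.apply]
  simpa using key Finset.univ

/-- Negations of indeterminates realize all changes of their signs. -/
theorem transformsTo_inst_signs {allowed : Op p n k → Prop} (ha : ∀ i, allowed (.instNeg i))
    (G : Design p n k) (η : Fin k → ℤˣ) :
    TransformsTo allowed G (G.map (Entry.twist η fun _ => false)) := by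
  classical
  have key : ∀ F : Finset (Fin k), TransformsTo allowed G
      (G.map (Entry.twist (fun i => if i ∈ F then η i else 1) fun _ => false)) := by
    intro F
    induction F using Finset.induction_on with
    | empty =>
      have h0 : G.map (Entry.twist (fun i => if i ∈ (∅ : Finset (Fin k)) then η i else 1)
          fun _ => false) = G := by
        ext r c
        rw [Matrix.map_apply]
        induction G r c <;> simp
      rw [h0]
      exact Relation.ReflTransGen.refl
    | insert q F hq ih =>
      rcases Int.units_eq_one_or (η q) with h1 | h1
      · convert ih using 3
        funext i
        by_cases hi : i = q
        · subst hi; simp [h1]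
        · simp [hi]
      · convert ih.trans (TransformsTo.of_op _ (ha q)) using 1
        ext r c
        simp only [Op.apply, Matrix.map_apply]
        induction G r c with
        | zero => rfl
        | var s b i =>
          by_cases hi : i = q
          · subst hi; simp [h1, hq, Entry.negVar]
          · simp [hi, Entry.negVar]
  simpa using key Finset.univ

theorem equivalentWithoutColNeg_of_data {G H : Design p n k} (σ : Equiv.Perm (Fin p))
    (κ : Equiv.Perm (Fin n)) (τ : Equiv.Perm (Fin k)) (ρ : Fin p → ℤˣ) (η : Fin k → ℤˣ)
    (hH : ∀ r c, H r c = ρ r • ((G (σ r) (κ c)).rename τ).twist η fun _ => false) :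
    EquivalentWithoutColNeg G H := by
  have h1 : EquivalentWithoutColNeg G (Op.apply (.rowPerm σ) G) :=
    TransformsTo.of_op _ (fun _ => nofun)
  have h2 := h1.trans (TransformsTo.of_op _ (o := .colPerm κ) (fun _ => nofun))
  have h3 := h2.trans (TransformsTo.of_op _ (o := .instRename τ) (fun _ => nofun))
  have h4 := h3.trans (transformsTo_inst_signs (fun _ _ => nofun) _ η)
  have h5 := h4.trans (transformsTo_row_signs (fun _ _ => nofun) _ ρ)
  unfold EquivalentWithoutColNeg
  convert h5 using 1
  ext r c
  simp [Op.apply, hH]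

/-- Match equal cube labels. The factor `cubeSign` is common, so the signs differ only by factors of
rows and of indeterminates. -/
theorem Modelled.equivalentWithoutColNeg {m : ℕ} {G H : Design p (2 * m) k} (hG : Modelled G)
    (hH : Modelled H) : EquivalentWithoutColNeg G H := by
  obtain ⟨A, C, V, ρ, η, hG⟩ := hG
  obtain ⟨A', C', V', ρ', η', hH⟩ := hH
  refine equivalentWithoutColNeg_of_data (A'.symm.trans A) (C'.symm.trans C) (V.symm.trans V')
    (fun r => ρ' (A'.symm r) * ρ (A'.symm r)) (fun j => η' (V'.symm j) * η (V'.symm j)) ?_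
  intro r c
  obtain ⟨⟨x, b⟩, rfl⟩ := A'.surjective r
  obtain ⟨⟨i, a⟩, rfl⟩ := C'.surjective c
  simp only [Equiv.trans_apply, Equiv.symm_apply_apply, hG, hH]
  split_ifs with h
  · simp only [Entry.rename_var, Entry.twist_var, Entry.smul_var, Equiv.trans_apply,
      Equiv.symm_apply_apply, Bool.xor_false, Entry.var.injEq, and_true]
    have h1 := Int.units_mul_self (ρ (x, b))
    have h2 := Int.units_mul_self (η (x.flip i))
    generalize ρ (x, b) = u at *
    generalize η (x.flip i) = w at *
    symm
    calc _ = ρ' (x, b) * η' (x.flip i) * cubeSign x.1 i * (u * u) * (w * w) := by ac_rfl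
      _ = _ := by rw [h1, h2, mul_one, mul_one]
  · rfl

end Transformations

/-! ### Closed sets of indeterminates and direct sums. -/

section Decomposition

variable {p n k : ℕ}

/-- The rows of a COD that involve a set of indeterminates, the other rows not involving them,
form a COD. -/
theorem IsCOD.restrict {p₁ k₁ : ℕ} {G : Design p n k} (hG : IsCOD G) {Pr : Fin p → Prop}
    {Pk : Fin k → Prop} (hin : ∀ r c s b j, G r c = .var s b j → (Pk j ↔ Pr r))
    (er : Fin p₁ ≃ {r // Pr r}) (ek : Fin k₁ ≃ {j // Pk j}) (hk : 0 < k₁) {g : Fin k → Fin k₁}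
    (hg : ∀ i, g (ek i).1 = i) :
    IsCOD (Matrix.of fun r c => (G (er r).1 c).rename g : Design p₁ n k₁) := by
  classical
  refine ⟨hk, fun v₁ => ?_⟩
  -- Setting the other indeterminates to zero kills the other rows and their part of the norm.
  set v : Fin k → ℂ := fun j => if Pk j then v₁ (g j) else 0 with hv
  have hsum : ∑ j, ‖v j‖ ^ 2 = ∑ i, ‖v₁ i‖ ^ 2 := by
    rw [← Fintype.sum_subtype_add_sum_subtype Pk, ← Equiv.sum_comp ek]
    have h0 : ∑ j : {j // ¬ Pk j}, ‖v j.1‖ ^ 2 = 0 :=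
      Finset.sum_eq_zero fun j _ => by simp [hv, j.2]
    rw [h0, add_zero]
    exact Finset.sum_congr rfl fun i _ => by simp [hv, (ek i).2, hg]
  have hpos : ∀ r c, Pr r → (G r c).eval v = ((G r c).rename g).eval v₁ := by
    intro r c hr
    induction hx : G r c with
    | zero => rfl
    | var s b j => simp [Entry.eval, hv, (hin _ _ _ _ _ hx).2 hr]
  have hneg : ∀ r c, ¬ Pr r → (G r c).eval v = 0 := by
    intro r c hr
    induction hx : G r c with
    | zero => rfl
    | var s b j => simp [Entry.eval, hv, mt (hin _ _ _ _ _ hx).1 hr]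
  rw [← hsum, ← hG.2 v]
  ext c d
  simp only [Matrix.mul_apply, Matrix.conjTranspose_apply, Matrix.map_apply, Matrix.of_apply]
  rw [← Fintype.sum_subtype_add_sum_subtype Pr (fun r => star ((G r c).eval v) * (G r d).eval v),
    ← Equiv.sum_comp er]
  have h0 : ∑ r : {r // ¬ Pr r}, star ((G r.1 c).eval v) * (G r.1 d).eval v = 0 :=
    Finset.sum_eq_zero fun r _ => by simp [hneg _ _ r.2]
  rw [h0, add_zero]
  exact Finset.sum_congr rfl fun i _ => by rw [hpos _ _ (er i).2, hpos _ _ (er i).2]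

/-- A row meeting `K` involves only indeterminates of `K`, so `K` and its complement occupy disjoint
sets of rows, each forming a COD. -/
theorem IsCOD.decomposable {G : Design p n k} (hG : IsCOD G) {K : Fin k → Prop}
    (hK : ∀ j l, K j → Shares G j l → K l) {j₀ l₀ : Fin k} (hj₀ : K j₀) (hl₀ : ¬ K l₀) :
    Decomposable G := by
  classical
  let Pr : Fin p → Prop := fun r => ∃ c s b j, K j ∧ G r c = .var s b j
  have hin : ∀ r c s b j, G r c = .var s b j → (K j ↔ Pr r) := by
    intro r c s b j hj
    refine ⟨fun h => ⟨c, s, b, j, h, hj⟩, ?_⟩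
    rintro ⟨d, s', b', l, hl, hd⟩
    exact hK l j hl ⟨r, d, c, s', b', s, b, hd, hj⟩
  let er₁ := (Fintype.equivFin {r // Pr r}).symm
  let er₂ := (Fintype.equivFin {r // ¬ Pr r}).symm
  let ek₁ := (Fintype.equivFin {j // K j}).symm
  let ek₂ := (Fintype.equivFin {j // ¬ K j}).symm
  have hk₁ : 0 < Fintype.card {j // K j} := Fintype.card_pos_iff.2 ⟨⟨j₀, hj₀⟩⟩
  have hk₂ : 0 < Fintype.card {j // ¬ K j} := Fintype.card_pos_iff.2 ⟨⟨l₀, hl₀⟩⟩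
  let g₁ : Fin k → Fin (Fintype.card {j // K j}) := fun j =>
    if h : K j then ek₁.symm ⟨j, h⟩ else ⟨0, hk₁⟩
  let g₂ : Fin k → Fin (Fintype.card {j // ¬ K j}) := fun j =>
    if h : ¬ K j then ek₂.symm ⟨j, h⟩ else ⟨0, hk₂⟩
  have hg₁ : ∀ i, g₁ (ek₁ i).1 = i := fun i => by
    simp only [g₁, dif_pos (ek₁ i).2, Subtype.coe_eta, Equiv.symm_apply_apply]
  have hg₂ : ∀ i, g₂ (ek₂ i).1 = i := fun i => by
    simp only [g₂, dif_pos (ek₂ i).2, Subtype.coe_eta, Equiv.symm_apply_apply]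
  let e := ((finSumFinEquiv.symm.trans (Equiv.sumCongr er₁ er₂)).trans
    (Equiv.sumCompl Pr)).symm
  let t := (finSumFinEquiv.symm.trans (Equiv.sumCongr ek₁ ek₂)).trans (Equiv.sumCompl K)
  have he₁ : ∀ r (h : Pr r), e r = Fin.castAdd _ (er₁.symm ⟨r, h⟩) := by
    intro r h
    rw [Equiv.symm_apply_eq]
    simp
  have he₂ : ∀ r (h : ¬ Pr r), e r = Fin.natAdd _ (er₂.symm ⟨r, h⟩) := by
    intro r h
    rw [Equiv.symm_apply_eq]
    simp
  have ht₁ : ∀ j, K j → t (Fin.castAdd _ (g₁ j)) = j := by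
    intro j h
    simp [t, g₁, h]
  have ht₂ : ∀ j, ¬ K j → t (Fin.natAdd _ (g₂ j)) = j := by
    intro j h
    simp [t, g₂, h]
  refine ⟨_, _, _, _, _, _, e, t, hG.restrict hin er₁ ek₁ hk₁ hg₁,
    hG.restrict (Pr := fun r => ¬ Pr r) (Pk := fun j => ¬ K j)
      (fun r c s b j h => not_congr (hin r c s b j h)) er₂ ek₂ hk₂ hg₂, ?_⟩
  ext r c
  simp only [Matrix.map_apply, Matrix.submatrix_apply, directSum, Matrix.of_apply, id]
  by_cases hr : Pr r
  · rw [he₁ r hr, Fin.append_left]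
    simp only [Equiv.apply_symm_apply]
    induction hx : G r c with
    | zero => rfl
    | var s b j => simp [ht₁ j ((hin _ _ _ _ _ hx).2 hr)]
  · rw [he₂ r hr, Fin.append_right]
    simp only [Equiv.apply_symm_apply]
    induction hx : G r c with
    | zero => rfl
    | var s b j => simp [ht₂ j (fun h => hr ((hin _ _ _ _ _ hx).1 h))]

theorem IsCOD.connected_of_indecomposable {G : Design p n k} (hG : IsCOD G)
    (hi : Indecomposable G) : Connected G := by
  intro j l
  by_contra hl
  exact hi (hG.decomposable (K := fun l => Relation.ReflTransGen (Shares G) j l)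
    (fun _ _ h1 h2 => h1.tail h2) Relation.ReflTransGen.refl hl)

/-- The indeterminates of a first summand would form a nonempty closed set, hence be all of them,
leaving none for the second. -/
theorem IsBCOD.indecomposable {m : ℕ} (hm : 1 ≤ m) {G : Design p (2 * m) (2 ^ (m - 1))}
    (hG : IsBCOD G) : Indecomposable G := by
  rintro ⟨p₁, p₂, k₁, k₂, G₁, G₂, e, t, h₁, h₂, hGe⟩
  have key := hG.eq_univ_of_closed hm (K := {l | ∃ i, l = t (Fin.castAdd k₂ i)})
    (j₀ := t (Fin.castAdd k₂ ⟨0, h₁.1⟩)) (by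
      rintro j l ⟨i, rfl⟩ ⟨r, c, d, s, b, s', b', hc, hd⟩
      rw [hGe] at hc hd
      simp only [Matrix.map_apply, Matrix.submatrix_apply, directSum, Matrix.of_apply, id] at hc hd
      revert hc hd
      refine Fin.addCases (fun q => ?_) (fun q => ?_) (e r)
      · rw [Fin.append_left]
        intro _ hd
        induction hx : G₁ q d with
        | zero => rw [hx] at hd; simp at hd
        | var s b j =>
          rw [hx] at hd
          simp only [Entry.rename_var, Entry.var.injEq] at hd
          exact ⟨j, hd.2.2.symm⟩
      · rw [Fin.append_right]
        intro hc _
        induction hx : G₂ q c with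
        | zero => rw [hx] at hc; simp at hc
        | var s b j =>
          rw [hx] at hc
          simp only [Entry.rename_var, Entry.var.injEq, EmbeddingLike.apply_eq_iff_eq] at hc
          have := congrArg Fin.val hc.2.2
          simp only [Fin.val_natAdd, Fin.val_castAdd] at this
          omega) ⟨_, rfl⟩
  obtain ⟨i, hi⟩ := key (t (Fin.natAdd k₁ ⟨0, h₂.1⟩))
  have := congrArg Fin.val (t.injective hi)
  simp only [Fin.val_natAdd, Fin.val_castAdd] at this
  omega

end Decomposition

/-! ### The standard signed cube is a BCOD. -/

section StandardDesign

variable {p m k : ℕ} (A : OddVertex m × Bool ≃ Fin p) (C : Fin m × Bool ≃ Fin (2 * m))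
  (V : EvenVertex m ≃ Fin k)

/-- The standard design of the cube, with given names of rows, columns and indeterminates. -/
def standardDesign : Design p (2 * m) k := Matrix.of fun r c =>
  if (C.symm c).2 = xor ((A.symm r).1.1 (C.symm c).1) (A.symm r).2 then
    .var (cubeSign (A.symm r).1.1 (C.symm c).1) (A.symm r).2 (V ((A.symm r).1.flip (C.symm c).1))
  else 0

theorem standardDesign_apply (x : OddVertex m) (b : Bool) (i : Fin m) (a : Bool) :
    standardDesign A C V (A (x, b)) (C (i, a)) =
      if a = xor (x.1 i) b then .var (cubeSign x.1 i) b (V (x.flip i)) else 0 := by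
  simp [standardDesign]

theorem modelled_standardDesign : Modelled (standardDesign A C V) :=
  ⟨A, C, V, 1, 1, fun x b i a => by simp [standardDesign_apply]⟩

theorem standardDesign_eval (v : Fin k → ℂ) (x : OddVertex m) (b : Bool) (i : Fin m) (a : Bool) :
    (standardDesign A C V (A (x, b)) (C (i, a))).eval v =
      if a = xor (x.1 i) b then ((cubeSign x.1 i : ℤ) : ℂ) *
        (if b then star (v (V (x.flip i))) else v (V (x.flip i))) else 0 := by
  rw [standardDesign_apply]
  split_ifs <;> simp_all [Entry.eval]

theorem isCOD_standardDesign : IsCOD (standardDesign A C V) := by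
  classical
  have hk : 0 < k := by
    have := (V ⟨fun _ => false, by simp [parity]⟩).2
    omega
  refine ⟨hk, fun v => ?_⟩
  ext c d
  obtain ⟨⟨i, a⟩, rfl⟩ := C.surjective c
  obtain ⟨⟨s, a'⟩, rfl⟩ := C.surjective d
  simp only [Matrix.mul_apply, Matrix.conjTranspose_apply, Matrix.map_apply, Matrix.smul_apply]
  rw [← Equiv.sum_comp A]
  by_cases his : i = s
  · subst his
    by_cases haa : a = a'
    · subst haa
      rw [Matrix.one_apply_eq, ← Equiv.sum_comp V, ← Equiv.sum_comp (flipEquiv i),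
        Fintype.sum_prod_type, smul_eq_mul, mul_one]
      push_cast
      refine Finset.sum_congr rfl fun x _ => ?_
      change _ = ((‖v (V (x.flip i))‖ : ℂ)) ^ 2
      have hε : ((cubeSign x.1 i : ℤ) : ℂ) * ((cubeSign x.1 i : ℤ) : ℂ) = 1 := by
        rw [← Int.cast_mul, ← Units.val_mul, Int.units_mul_self]; simp
      have hn : ((‖v (V (x.flip i))‖ : ℂ)) ^ 2 =
          (starRingEnd ℂ) (v (V (x.flip i))) * v (V (x.flip i)) := by
        rw [mul_comm, Complex.mul_conj, Complex.normSq_eq_norm_sq]; push_cast; rfl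
      rw [hn, Fintype.sum_bool]
      simp only [standardDesign_eval]
      cases a <;> cases x.1 i <;> simp <;> linear_combination
        ((starRingEnd ℂ) (v (V (x.flip i))) * v (V (x.flip i))) * hε
    · have hne : C (i, a) ≠ C (i, a') := by
        intro e
        exact haa (congrArg Prod.snd (C.injective e))
      rw [Matrix.one_apply_ne hne, smul_zero]
      refine Finset.sum_eq_zero fun q _ => ?_
      obtain ⟨x, b⟩ := q
      rw [standardDesign_eval, standardDesign_eval]
      by_cases h1 : a = xor (x.1 i) b
      · have h2 : a' ≠ xor (x.1 i) b := fun h2 => haa (h1.trans h2.symm)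
        rw [if_neg h2, mul_zero]
      · rw [if_neg h1, star_zero, zero_mul]
  · have hne : C (i, a) ≠ C (s, a') := by
      intro e
      exact his (congrArg Prod.fst (C.injective e))
    rw [Matrix.one_apply_ne hne, smul_zero]
    -- Columns in different directions: the opposite corner of the square, with the other
    -- conjugation, contributes the same product with opposite sign by `cubeSign_square`.
    refine Finset.sum_involution (fun q _ => ((q.1.flip i).flip s, !q.2)) ?_ ?_ (by simp) ?_
    · rintro ⟨x, b⟩ -
      simp only [standardDesign_eval]
      have v1 : ((x.flip i).flip s).1 s = !x.1 s := by
        change flip (flip x.1 i) s s = _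
        rw [flip_same, flip_of_ne _ (Ne.symm his)]
      have v2 : ((x.flip i).flip s).1 i = !x.1 i := by
        change flip (flip x.1 i) s i = _
        rw [flip_of_ne _ his, flip_same]
      have f1 : ((x.flip i).flip s).flip s = x.flip i := EvenVertex.flip_flip _ _
      have f2 : ((x.flip i).flip s).flip i = x.flip s := by
        refine Subtype.ext ?_
        change flip (flip (flip x.1 i) s) i = flip x.1 s
        rw [flip_comm, flip_flip]
      have hsq : ((cubeSign x.1 i : ℤ) : ℂ) * ((cubeSign x.1 s : ℤ) : ℂ) =
          -(((cubeSign ((x.flip i).flip s).1 i : ℤ) : ℂ) *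
            ((cubeSign ((x.flip i).flip s).1 s : ℤ) : ℂ)) := by
        have := cubeSign_square x.1 his
        have := congrArg (fun u : ℤˣ => ((u : ℤ) : ℂ)) this
        push_cast at this
        exact this
      rw [v1, v2, f1, f2]
      have hb : ∀ u b, xor (!u) (!b) = xor u b := by decide
      rw [hb, hb]
      by_cases h1 : a = xor (x.1 i) b
      · by_cases h2 : a' = xor (x.1 s) b
        · simp only [if_pos h1, if_pos h2]
          cases b
          · simp
            linear_combination ((starRingEnd ℂ) (v (V (x.flip i))) * v (V (x.flip s))) * hsq
          · simp
            linear_combination ((starRingEnd ℂ) (v (V (x.flip s))) * v (V (x.flip i))) * hsq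
        · simp [h2]
      · simp [h1]
    · rintro ⟨x, b⟩ - - e
      have := congrArg Prod.snd e
      simp at this
    · rintro ⟨x, b⟩ -
      refine Prod.ext (Subtype.ext ?_) (by simp)
      change flip (flip (flip (flip x.1 i) s) i) s = x.1
      rw [flip_comm (flip x.1 i) s i, flip_flip, flip_flip]

theorem standardDesign_ne_zero_iff (x : OddVertex m) (b : Bool) (i : Fin m) (a : Bool) :
    standardDesign A C V (A (x, b)) (C (i, a)) ≠ 0 ↔ a = xor (x.1 i) b := by
  rw [standardDesign_apply]
  split_ifs with h <;> simp [h]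

theorem card_nonzero_standardDesign (r : Fin p) :
    (Finset.univ.filter fun c => standardDesign A C V r c ≠ 0).card = m := by
  classical
  obtain ⟨⟨x, b⟩, rfl⟩ := A.surjective r
  have : (Finset.univ.filter fun c => standardDesign A C V (A (x, b)) c ≠ 0) =
      Finset.univ.image fun i => C (i, xor (x.1 i) b) := by
    ext c
    obtain ⟨⟨i, a⟩, rfl⟩ := C.surjective c
    rw [Finset.mem_filter, standardDesign_ne_zero_iff]
    simp only [Finset.mem_univ, true_and, Finset.mem_image, C.injective.eq_iff, Prod.mk.injEq]
    constructor
    · rintro rfl; exact ⟨i, rfl, rfl⟩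
    · rintro ⟨i, rfl, rfl⟩; rfl
  rw [this, Finset.card_image_of_injective, Finset.card_univ, Fintype.card_fin]
  intro i i' e
  exact congrArg Prod.fst (C.injective e)

/-- The columns split into the two halves belonging to a vertex. -/
def vertexHalves (y : Fin m → Bool) : Fin m ⊕ Fin m ≃ Fin m × Bool where
  toFun := Sum.elim (fun i => (i, !y i)) (fun i => (i, y i))
  invFun q := if q.2 = y q.1 then Sum.inr q.1 else Sum.inl q.1
  left_inv q := by rcases q with i | i <;> simp
  right_inv q := by
    obtain ⟨i, a⟩ := q
    by_cases h : a = y i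
    · simp [h]
    · have : (!y i) = a := by
        revert h
        cases a <;> cases y i <;> simp
      simp [h, this]

/-- For the indeterminate at `y`, take the rows at the m neighbours of `y`, in both conjugations,
and order the columns by the sides of `y`. Off the diagonal the block holds the double flips of `y`,
and the square relation makes it skew. -/
theorem skew_standardDesign (j : Fin k) : ∃ G' : Design p (2 * m) k,
    TransformsTo (fun o => o.NotColNeg ∧ o.NotRename) (standardDesign A C V) G' ∧
      ContainsSkewB j G' := by
  classical
  obtain ⟨y, rfl⟩ := V.surjective j
  have hfinj : ∀ {i i' : Fin m}, y.flip i = y.flip i' → i = i' := by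
    intro i i' e
    by_contra hne
    have := congrFun (congrArg Subtype.val e) i
    change flip y.1 i i = flip y.1 i' i at this
    rw [flip_same, flip_of_ne _ hne] at this
    simp at this
  obtain ⟨f, hfl, hfr⟩ : ∃ f : Fin m ⊕ Fin m ↪ Fin p,
      (∀ i, f (Sum.inl i) = A (y.flip i, false)) ∧ ∀ i, f (Sum.inr i) = A (y.flip i, true) := by
    refine ⟨⟨Sum.elim (fun i => A (y.flip i, false)) (fun i => A (y.flip i, true)), ?_⟩,
      fun _ => rfl, fun _ => rfl⟩
    rintro (i | i) (i' | i') e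
    · rw [hfinj (congrArg Prod.fst (A.injective e))]
    · simpa using congrArg Prod.snd (A.injective e)
    · simpa using congrArg Prod.snd (A.injective e)
    · rw [hfinj (congrArg Prod.fst (A.injective e))]
  -- These signs cancel those of `z_j`; rows outside the block keep sign 1.
  let ρ : Fin p → ℤˣ := Function.extend f (fun q => cubeSign y.1 (Sum.elim id id q)) 1
  have hρ : ∀ q, ρ (f q) = cubeSign y.1 (Sum.elim id id q) := fun q =>
    f.injective.extend_apply _ _ q
  let κ : Equiv.Perm (Fin (2 * m)) := (halves m).symm.trans ((vertexHalves y.1).trans C)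
  let M : Matrix (Fin m) (Fin m) (Entry k) := Matrix.of fun i l =>
    if i = l then 0 else
      .var (cubeSign y.1 i * cubeSign (flip y.1 i) l) false (V ((y.flip i).flip l))
  have hM : ∀ i l, M l i = -M i l := by
    intro i l
    by_cases h : i = l
    · simp [M, h]
    · simp only [M, Matrix.of_apply, if_neg h, if_neg (Ne.symm h), Entry.neg_var,
        Entry.var.injEq, true_and]
      have hsq := cubeSign_square_edges y.1 h
      have h1 := Int.units_mul_self (cubeSign y.1 l)
      have h2 := Int.units_mul_self (cubeSign (flip y.1 i) l)
      constructor
      · generalize cubeSign y.1 l = u1 at *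
        generalize cubeSign y.1 i = u2 at *
        generalize cubeSign (flip y.1 i) l = u3 at *
        generalize cubeSign (flip y.1 l) i = u4 at *
        have e : u2 * u3 = -(u4 * u1) := by
          calc u2 * u3 = (u2 * u1) * (u1 * u3) := by
                rw [mul_assoc, ← mul_assoc u1 u1, h1, one_mul]
            _ = -(u4 * u1) * (u3 * u3) := by rw [hsq, neg_mul, neg_mul]; congr 1; ac_rfl
            _ = _ := by rw [h2, mul_one]
        rw [e, neg_neg, mul_comm]
      · exact congrArg V (Subtype.ext (flip_comm _ _ _))
  refine ⟨_, (TransformsTo.of_op _ (o := .colPerm κ) ⟨fun _ => nofun, fun _ => nofun⟩).trans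
    (transformsTo_row_signs (fun _ => ⟨fun _ => nofun, fun _ => nofun⟩) _ ρ), f, M, ?_, ?_⟩
  · ext i l : 2
    exact hM i l
  · have hflip : ∀ i l, (y.flip i).1 l = if l = i then !y.1 l else y.1 l := by
      intro i l
      change flip y.1 i l = _
      by_cases h : l = i
      · subst h; simp
      · rw [flip_of_ne _ h, if_neg h]
    have hcs : ∀ i, cubeSign (y.flip i).1 i = cubeSign y.1 i := fun i =>
      cubeSign_flip_of_le _ le_rfl
    ext q q' : 2
    rw [Matrix.submatrix_apply, Matrix.of_apply, hρ]
    have hκ : κ (halves m q') = C (vertexHalves y.1 q') := by simp [κ]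
    simp only [Op.apply, Matrix.submatrix_apply, id, hκ]
    rcases q with i | i <;> rcases q' with l | l
    · simp only [hfl, Sum.elim_inl, vertexHalves, Equiv.coe_fn_mk, id,
        standardDesign_apply, hflip, Matrix.fromBlocks_apply₁₁]
      by_cases h : l = i
      · subst h
        simp [hcs, Int.units_mul_self, Entry.z]
      · rw [Matrix.diagonal_apply_ne _ (Ne.symm h)]
        simp [h]
    · simp only [hfl, Sum.elim_inl, Sum.elim_inr, vertexHalves,
        Equiv.coe_fn_mk, id, standardDesign_apply, hflip, Matrix.fromBlocks_apply₁₂]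
      by_cases h : l = i
      · subst h
        simp [M]
      · simp [h, M, Ne.symm h]
        rfl
    · simp only [hfr, Sum.elim_inl, Sum.elim_inr, vertexHalves,
        Equiv.coe_fn_mk, id, standardDesign_apply, hflip, Matrix.fromBlocks_apply₂₁]
      rw [Matrix.neg_apply, Matrix.conjTranspose_apply, hM i l, Entry.star_neg_entry,
        Entry.neg_neg_entry]
      by_cases h : l = i
      · subst h
        simp [M]
      · simp [h, M, Ne.symm h]
        rfl
    · simp only [hfr, Sum.elim_inr, vertexHalves, Equiv.coe_fn_mk, id,
        standardDesign_apply, hflip, Matrix.fromBlocks_apply₂₂]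
      by_cases h : l = i
      · subst h
        simp [hcs, Int.units_mul_self, Entry.z]
      · rw [Matrix.diagonal_apply_ne _ (Ne.symm h)]
        simp [h]

theorem isBCOD_standardDesign : IsBCOD (standardDesign A C V) where
  isCOD := isCOD_standardDesign A C V
  card_nonzero := card_nonzero_standardDesign A C V
  card_zero r := by
    have h1 := card_nonzero_standardDesign A C V r
    have h2 := Finset.card_filter_add_card_filter_not (s := (Finset.univ : Finset (Fin (2 * m))))
      (fun c => standardDesign A C V r c = 0)
    rw [Finset.card_univ, Fintype.card_fin] at h2
    simp only [ne_eq] at h1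
    omega
  conjSep r := by
    obtain ⟨⟨x, b⟩, rfl⟩ := A.surjective r
    refine ⟨b, fun c s b' l hl => ?_⟩
    obtain ⟨⟨i, a⟩, rfl⟩ := C.surjective c
    rw [standardDesign_apply] at hl
    split_ifs at hl
    simp only [Entry.var.injEq] at hl
    exact hl.2.1.symm
  skew := skew_standardDesign A C V

end StandardDesign

theorem Design.cast_self {p n k : ℕ} (G : Design p n k) : G.cast rfl rfl = G := by
  ext r c
  simp only [Design.cast, Matrix.map_apply, Matrix.submatrix_apply, id, Fin.cast_eq_self]
  induction G r c <;> simp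

end COD

/-! ### Uniqueness and existence. -/

theorem mainTheorem2 (m : ℕ) (hm : 1 ≤ m) :
    (∀ G H : COD.Design (2 ^ m) (2 * m) (2 ^ (m - 1)), COD.IsBCOD G → COD.IsBCOD H →
      COD.Equivalent G H ∧ COD.EquivalentWithoutColNeg G H) ∧
    (∃ G₀ : COD.Design (2 ^ m) (2 * m) (2 ^ (m - 1)),
      COD.IsBCOD G₀ ∧ COD.Indecomposable G₀ ∧
      ∀ (p k : ℕ) (G : COD.Design p (2 * m) k), COD.IsBCOD G → COD.Indecomposable G →
        ∃ (hp : p = 2 ^ m) (hk : k = 2 ^ (m - 1)),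
          COD.Equivalent (G.cast hp hk) G₀ ∧
            COD.EquivalentWithoutColNeg (G.cast hp hk) G₀) := by
  refine ⟨fun G H hG hH => ?_, ?_⟩
  · have h := (hG.modelled hm (hG.connected hm)).equivalentWithoutColNeg
      (hH.modelled hm (hH.connected hm))
    exact ⟨h.equivalent, h⟩
  · let A := Fintype.equivFinOfCardEq (COD.card_odd_prod_bool hm)
    let C : Fin m × Bool ≃ Fin (2 * m) := Fintype.equivFinOfCardEq (by simp [mul_comm])
    let V := Fintype.equivFinOfCardEq (COD.card_even hm)
    have h₀ := COD.isBCOD_standardDesign A C V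
    refine ⟨COD.standardDesign A C V, h₀, h₀.indecomposable hm, ?_⟩
    intro p k G hG hi
    have hM := hG.modelled hm (hG.isCOD.connected_of_indecomposable hi)
    -- The cube labels of rows and indeterminates alone determine `p` and `k`.
    obtain ⟨A', -, V', -⟩ := id hM
    have hp : p = 2 ^ m := by
      rw [← COD.card_odd_prod_bool hm, Fintype.card_congr A', Fintype.card_fin]
    have hk : k = 2 ^ (m - 1) := by
      rw [← COD.card_even hm, Fintype.card_congr V', Fintype.card_fin]
    subst hp hk
    have h := hM.equivalentWithoutColNeg (COD.modelled_standardDesign A C V)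
    refine ⟨rfl, rfl, ?_⟩
    rw [COD.Design.cast_self]
    exact ⟨h.equivalent, h⟩
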